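/- Let $(W,S)$ be a Coxeter group of finite rank, with length function $\ell$ and right weak order $\le$ (so for $s\in S$, $w\ge s$ iff $\ell(sw)<\ell(w)$). For $w\in W$ let $\mathrm{inv}(w)$ be the set of reflections $t$ with $\ell(tw)<\ell(w)$, and $\mathrm{cov}(w)$ the set of $t\in\mathrm{inv}(w)$ with $tw=ws$ for some $s\in S$. For $J\subseteq S$ write $w=w_J\cdot{}^Jw$, where ${}^Jw$ is the element of minimal length of the coset $W_Jw$ and $w_J\in W_J$; write $\langle s\rangle=S\setminus\{s\}$. Let $c=s_1\cdots s_n$ be a Coxeter element (the product of all simple generators, each taken once, in some order). The $(s_1\cdots s_n)$-sorting word of $w$ is the lexicographically first (as a sequence of positions) subword of the half-infinite word $(s_1\cdots s_n)^\infty$ that is a reduced word for $w$; it is called a $c$-sorting word of $w$. An element $v$ is $c$-sortable if, for a $c$-sorting word of $v$, the sets of letters used in the successive copies of $s_1\cdots s_n$ are weakly decreasing under inclusion. If $a_1\cdots a_k$ is a $c$-sorting word of $w$ and $r\in S$, consider the leftmost instance of $r$ in $(s_1\cdots s_n)^\infty$ that does not belong to the sorting word, and let $a_1\cdots a_i$ be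 the part of the sorting word before it; this skip of $r$ is unforced if $a_1\cdots a_i r$ is reduced. Let $\mathrm{ufs}_c(w)$ be the set of reflections $a_1\cdots a_i\,r\,a_i\cdots a_1$ over all unforced skips. For $s=s_1$ initial in $c$, define recursively (on rank and length) $\pi_\downarrow^c(w)=s\,\pi_\downarrow^{scs}(sw)$ if $w\ge s$, and $\pi_\downarrow^c(w)=\pi_\downarrow^{sc}(w_{\langle s\rangle})$, computed in $W_{\langle s\rangle}$, if $w\not\ge s$, with $\pi_\downarrow^c(e)=e$. (The recursion is carried out along any given reduced word $s_1\cdots s_n$ of $c$, using the reduced words $s_2\cdots s_ns_1$ of $scs$ and $s_2\cdots s_n$ of $sc$; the same applies to $C^r_c$ below.) Let $A=(a_{ss'})_{s,s'\in S}$ be a real generalized Cartan matrix for $W$: $a_{ss}=2$; for $s\ne s'$, $a_{ss'}\le 0$, and $a_{ss'}a_{s's}=4\cos^2(\pi/m(s,s'))$ if $m(s,s')<\infty$, while $a_{ss'}a_{s's}\ge 4$ if $m(s,s')=\infty$; and $a_{ss'}=0$ iff $a_{s's}=0$. Assume $A$ is symmetrizable: there is $\delta:S\to\mathbb R_{>0}$,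 constant on conjugate simple generators, with $\delta(s)a_{ss'}=\delta(s')a_{s's}$. Let $V$ be the real vector space with basis $(\alpha_s)_{s\in S}$, on which $W$ acts by $s(\alpha_{s'})=\alpha_{s'}-a_{ss'}\alpha_s$, and let $W$ act on $V^*$ dually. Put $D=\{x\in V^*:\langle x,\alpha_s\rangle\ge 0\ \forall s\in S\}$ and $\mathrm{Tits}(W)=\bigcup_{w\in W}wD$. For $v$ $c$-sortable, $r\in S$ and $s$ initial in $c$, let $C^r_c(v)=\alpha_r$ if $v\not\ge s$ and $r=s$; $C^r_c(v)=C^r_{sc}(v)$ (computed in $W_{\langle s\rangle}$) if $v\not\ge s$ and $r\neq s$; and $C^r_c(v)=s\,C^r_{scs}(sv)$ if $v\ge s$. Let $\mathrm{Cone}_c(v)=\{x\in V^*:\langle x,C^r_c(v)\rangle\ge 0\ \forall r\in S\}$. **Theorem.** Let $c$ be a Coxeter element of $W$ and let $v\in W$ be $c$-sortable. 1. For every $w\in W$: $\pi_\downarrow^c(w)=v$ if and only if $\mathrm{cov}(v)\subseteq\mathrm{inv}(w)$ and $\mathrm{ufs}_c(v)\cap\mathrm{inv}(w)=\emptyset$.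 2. For every symmetrizable generalized Cartan matrix $A$ for $W$: the vectors $C^r_c(v)$, $r\in S$, form a basis of $V$, so that $\mathrm{Cone}_c(v)$ is a full-dimensional simplicial cone; for every $w\in W$, $\pi_\downarrow^c(w)=v$ if and only if $wD\subseteq\mathrm{Cone}_c(v)$; and $$\bigcup_{w\in W,\ \pi_\downarrow^c(w)=v} wD=\mathrm{Cone}_c(v)\cap\mathrm{Tits}(W).$$ -/

import Mathlib

namespace Cambrian

/-! ### Generalized Cartan matrices and the reflection representation -/

/-- A generalized Cartan matrix (with real entries) for the Coxeter matrix `M`. In Mathlib the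
entry `M i j = 0` stands for `m(i, j) = ∞`. -/
structure IsGeneralizedCartan {B : Type*} (M : CoxeterMatrix B) (A : Matrix B B ℝ) : Prop where
  diag : ∀ i, A i i = 2
  nonpos : ∀ i j, i ≠ j → A i j ≤ 0
  mul_eq : ∀ i j, i ≠ j → M i j ≠ 0 → A i j * A j i = 4 * Real.cos (Real.pi / M i j) ^ 2
  mul_ge : ∀ i j, M i j = 0 → 4 ≤ A i j * A j i
  zero_iff : ∀ i j, A i j = 0 ↔ A j i = 0

/-- `A` is symmetrizable, by a positive function that is constant on the classes of conjugate
simple reflections. -/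
def IsSymmetrizable {B W : Type*} [Group W] {M : CoxeterMatrix B} (cs : CoxeterSystem M W)
    (A : Matrix B B ℝ) : Prop :=
  ∃ δ : B → ℝ, (∀ i, 0 < δ i) ∧ (∀ i j, δ i * A i j = δ j * A j i) ∧
    ∀ i j, IsConj (cs.simple i) (cs.simple j) → δ i = δ j

/-- The simple root `α_i`, a basis vector of `V = B →₀ ℝ`. -/
noncomputable def simpleRoot {B : Type*} (i : B) : B →₀ ℝ := Finsupp.single i 1

/-- The linear functional on `V` with `α_j ↦ a_{ij}`. -/
noncomputable def corootFunctional {B : Type*} (A : Matrix B B ℝ) (i : B) :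
    Module.Dual ℝ (B →₀ ℝ) :=
  Finsupp.linearCombination ℝ (A i)

theorem corootFunctional_simpleRoot {B : Type*} (A : Matrix B B ℝ) (i j : B) :
    corootFunctional A i (simpleRoot j) = A i j := by
  simp [corootFunctional, simpleRoot]

theorem corootFunctional_self {B : Type*} {M : CoxeterMatrix B} {A : Matrix B B ℝ}
    (hA : IsGeneralizedCartan M A) (i : B) :
    corootFunctional A i (simpleRoot i) = 2 := by
  rw [corootFunctional_simpleRoot, hA.diag]

/-- The simple reflection `α_j ↦ α_j - a_{ij} α_i` of `V`. -/
noncomputable def simpleReflection {B : Type*} {M : CoxeterMatrix B} {A : Matrix B B ℝ}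
    (hA : IsGeneralizedCartan M A) (i : B) : (B →₀ ℝ) ≃ₗ[ℝ] (B →₀ ℝ) :=
  Module.reflection (corootFunctional_self hA i)

theorem simpleReflection_simpleRoot {B : Type*} {M : CoxeterMatrix B} {A : Matrix B B ℝ}
    (hA : IsGeneralizedCartan M A) (i j : B) :
    simpleReflection hA i (simpleRoot j) = simpleRoot j - A i j • simpleRoot i := by
  rw [simpleReflection, Module.reflection_apply, corootFunctional_simpleRoot]

theorem isLiftable_simpleReflection {B : Type*} {M : CoxeterMatrix B} {A : Matrix B B ℝ}
    (hA : IsGeneralizedCartan M A) : M.IsLiftable (simpleReflection hA) := by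
  intro i j
  rcases eq_or_ne i j with rfl | hij
  · rw [M.diagonal, pow_one]
    ext1 x
    exact Module.involutive_reflection (corootFunctional_self hA i) x
  rcases eq_or_ne (M i j) 0 with h0 | h0
  · rw [h0, pow_zero]
  have h1 : M i j ≠ 1 := M.off_diagonal i j hij
  have hmul := hA.mul_eq i j hij h0
  rcases eq_or_ne (M i j) 2 with h2 | h2
  · have hz : A i j * A j i = 0 := by rw [hmul, h2]; simp
    have hij0 : A i j = 0 := by
      rcases mul_eq_zero.mp hz with h | h
      · exact h
      · exact (hA.zero_iff i j).mpr h
    have hji0 : A j i = 0 := (hA.zero_iff i j).mp hij0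
    rw [h2]
    ext1 x
    simp only [pow_two, LinearEquiv.mul_apply, simpleReflection, Module.reflection_apply, map_sub,
      map_smul, corootFunctional_simpleRoot, hij0, hji0, hA.diag, LinearEquiv.coe_one, id_eq]
    module
  set m := M i j with hm
  have hm3 : 3 ≤ m := by omega
  have hmR : (3 : ℝ) ≤ m := by exact_mod_cast hm3
  set θ : ℝ := 2 * (Real.pi / m) with hθ
  have hmθ : (m : ℝ) * θ = 2 * Real.pi := by rw [hθ]; field_simp
  have hsin : Real.sin θ ≠ 0 := by
    apply ne_of_gt
    apply Real.sin_pos_of_pos_of_lt_pi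
    · have := Real.pi_pos; positivity
    · have := Real.pi_pos
      nlinarith
  have ht : 2 * Real.cos θ = corootFunctional A i (simpleRoot j) *
      corootFunctional A j (simpleRoot i) - 2 := by
    rw [corootFunctional_simpleRoot, corootFunctional_simpleRoot, hmul, hθ, Real.cos_two_mul]
    ring
  have hS := Polynomial.Chebyshev.S_two_mul_real_cos θ
  ext1 x
  have key := Module.reflection_mul_reflection_pow_apply (corootFunctional_self hA i)
    (corootFunctional_self hA j) m x (2 * Real.cos θ) ht
  rw [simpleReflection, simpleReflection, key]
  obtain ⟨k, hk | hk⟩ : ∃ k : ℕ, m = 2 * k ∨ m = 2 * k + 1 := ⟨m / 2, by omega⟩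
  · have e1 : ((m : ℤ) - 2) / 2 = k - 1 := by omega
    have e2 : ((m : ℤ) - 1) / 2 = k - 1 := by omega
    have hk0 : (Polynomial.Chebyshev.S ℝ ((k : ℤ) - 1)).eval (2 * Real.cos θ) = 0 := by
      have h := hS ((k : ℤ) - 1)
      have : (((k : ℤ) - 1 : ℤ) + 1 : ℝ) * θ = Real.pi := by
        have : (m : ℝ) = 2 * k := by exact_mod_cast hk
        rw [this] at hmθ
        push_cast
        linarith
      rw [this, Real.sin_pi] at h
      exact (mul_eq_zero.mp h).resolve_right hsin
    rw [e1, e2, hk0]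
    simp
  · have e1 : ((m : ℤ) - 2) / 2 = k - 1 := by omega
    have e2 : ((m : ℤ) - 1) / 2 = k := by omega
    have e3 : ((m : ℤ) - 3) / 2 = k - 1 := by omega
    have e4 : (m : ℤ) / 2 = k := by omega
    have hk0 : (Polynomial.Chebyshev.S ℝ (k : ℤ)).eval (2 * Real.cos θ) +
        (Polynomial.Chebyshev.S ℝ ((k : ℤ) - 1)).eval (2 * Real.cos θ) = 0 := by
      have h := hS (k : ℤ)
      have h' := hS ((k : ℤ) - 1)
      have hsum : Real.sin (((k : ℤ) + 1 : ℝ) * θ) =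
          - Real.sin ((((k : ℤ) - 1 : ℤ) + 1 : ℝ) * θ) := by
        have hmk : (m : ℝ) = 2 * k + 1 := by exact_mod_cast hk
        rw [hmk] at hmθ
        have : ((k : ℤ) + 1 : ℝ) * θ = 2 * Real.pi - (((k : ℤ) - 1 : ℤ) + 1 : ℝ) * θ := by
          push_cast
          linarith
        rw [this, Real.sin_two_pi_sub]
      have : ((Polynomial.Chebyshev.S ℝ (k : ℤ)).eval (2 * Real.cos θ) +
        (Polynomial.Chebyshev.S ℝ ((k : ℤ) - 1)).eval (2 * Real.cos θ)) * Real.sin θ = 0 := by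
        rw [add_mul, h, h', hsum]
        ring
      exact (mul_eq_zero.mp this).resolve_right hsin
    rw [e1, e2, e3, e4, hk0]
    simp

/-- The reflection representation of `W` on `V = B →₀ ℝ` attached to a generalized Cartan matrix:
the simple generator `s_i` acts by `α_j ↦ α_j - a_{ij} α_i`. -/
noncomputable def reflRep {B W : Type*} [Group W] {M : CoxeterMatrix B} (cs : CoxeterSystem M W)
    {A : Matrix B B ℝ} (hA : IsGeneralizedCartan M A) : Representation ℝ W (B →₀ ℝ) :=
  LinearEquiv.automorphismGroup.toLinearMapMonoidHom.comp
    (cs.lift ⟨simpleReflection hA, isLiftable_simpleReflection hA⟩)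

theorem reflRep_simple_simpleRoot {B W : Type*} [Group W] {M : CoxeterMatrix B}
    (cs : CoxeterSystem M W) {A : Matrix B B ℝ} (hA : IsGeneralizedCartan M A) (i j : B) :
    reflRep cs hA (cs.simple i) (simpleRoot j) = simpleRoot j - A i j • simpleRoot i := by
  rw [← simpleReflection_simpleRoot hA, reflRep, MonoidHom.comp_apply, cs.lift_apply_simple]
  rfl

/-- The dominant chamber `D` in `V*`. -/
def dominantChamber (B : Type*) : Set (Module.Dual ℝ (B →₀ ℝ)) :=
  {x | ∀ i, 0 ≤ x (simpleRoot i)}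

/-- The chamber `wD`, for the dual action of `W` on `V*`. -/
def chamber {B W : Type*} [Group W] {M : CoxeterMatrix B} (cs : CoxeterSystem M W)
    {A : Matrix B B ℝ} (hA : IsGeneralizedCartan M A) (w : W) :
    Set (Module.Dual ℝ (B →₀ ℝ)) :=
  (fun x => (reflRep cs hA).dual w x) '' dominantChamber B

/-- The Tits cone: the union of all chambers. -/
def titsCone {B W : Type*} [Group W] {M : CoxeterMatrix B} (cs : CoxeterSystem M W)
    {A : Matrix B B ℝ} (hA : IsGeneralizedCartan M A) : Set (Module.Dual ℝ (B →₀ ℝ)) :=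
  ⋃ w : W, chamber cs hA w

/-! ### Inversions, cover reflections, parabolic factors -/

/-- The set of inversions of `w`: the reflections `t` with `ℓ(tw) < ℓ(w)`. -/
def inv {B W : Type*} [Group W] {M : CoxeterMatrix B} (cs : CoxeterSystem M W) (w : W) : Set W :=
  {t | cs.IsLeftInversion w t}

/-- The set of cover reflections of `w`: the inversions `t` with `tw = ws` for a simple `s`. -/
def cov {B W : Type*} [Group W] {M : CoxeterMatrix B} (cs : CoxeterSystem M W) (w : W) : Set W :=
  {t | t ∈ inv cs w ∧ ∃ i, t * w = w * cs.simple i}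

/-- The standard parabolic subgroup `W_J`. -/
def parabolic {B W : Type*} [Group W] {M : CoxeterMatrix B} (cs : CoxeterSystem M W)
    (J : Set B) : Subgroup W :=
  Subgroup.closure (cs.simple '' J)

/-- The representative of minimal length of the coset `W_J w`. -/
noncomputable def minCosetRep {B W : Type*} [Group W] {M : CoxeterMatrix B}
    (cs : CoxeterSystem M W) (J : Set B) (w : W) : W :=
  Function.argminOn cs.length {x | w * x⁻¹ ∈ parabolic cs J} ⟨w, by simp [one_mem]⟩

/-- The factor `w_J ∈ W_J` of the factorization of `w` as an element of `W_J` times the minimal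
representative of the coset `W_J w`. -/
noncomputable def parabolicPart {B W : Type*} [Group W] {M : CoxeterMatrix B}
    (cs : CoxeterSystem M W) (J : Set B) (w : W) : W :=
  w * (minCosetRep cs J w)⁻¹

/-! ### Coxeter elements, sorting words, sortable elements -/

/-- The word `l = s₁ ⋯ s_n` uses every simple generator exactly once and has product `c`; that is,
`c` is a Coxeter element and `l` is one of its reduced words. -/
def IsCoxeterWord {B W : Type*} [Group W] {M : CoxeterMatrix B} (cs : CoxeterSystem M W)
    (c : W) (l : List B) : Prop :=
  l.Nodup ∧ (∀ i, i ∈ l) ∧ cs.wordProd l = c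

/-- The letter at position `k` (counted from `0`) of the half-infinite word `l^∞`. It is `none`
only if `l` is empty. -/
def periodicLetter {B : Type*} (l : List B) (k : ℕ) : Option B := l[k % l.length]?

/-- The increasing list of positions `p` picks out the subword `a` of `l^∞`, and `a` is a reduced
word for `w`. -/
def IsReducedSubword {B W : Type*} [Group W] {M : CoxeterMatrix B} (cs : CoxeterSystem M W)
    (l : List B) (w : W) (p : List ℕ) (a : List B) : Prop :=
  p.Pairwise (· < ·) ∧ p.map (periodicLetter l) = a.map some ∧ cs.IsReduced a ∧ cs.wordProd a = w

/-- `a` is the `l`-sorting word of `w`, placed at the positions `p` of `l^∞`: the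
lexicographically first (as a list of positions) subword of `l^∞` which is a reduced word
for `w`. -/
def IsSortingWord {B W : Type*} [Group W] {M : CoxeterMatrix B} (cs : CoxeterSystem M W)
    (l : List B) (w : W) (p : List ℕ) (a : List B) : Prop :=
  IsReducedSubword cs l w p a ∧ ∀ q b, IsReducedSubword cs l w q b → p ≤ q

/-- The set of letters picked out by the positions `p` in the `k`-th copy (counted from `0`) of `l`
in `l^∞`. -/
def blockLetters {B : Type*} (l : List B) (p : List ℕ) (k : ℕ) : Set B :=
  {i | ∃ x ∈ p, x / l.length = k ∧ periodicLetter l x = some i}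

/-- `v` is `c`-sortable: a `c`-sorting word for `v` defines a sequence of subsets of the simple
generators which is weakly decreasing under inclusion. -/
def IsSortable {B W : Type*} [Group W] {M : CoxeterMatrix B} (cs : CoxeterSystem M W)
    (c v : W) : Prop :=
  ∃ l, IsCoxeterWord cs c l ∧ ∃ p a, IsSortingWord cs l v p a ∧ Antitone (blockLetters l p)

/-- The initial part `u = a₁ ⋯ a_i` of the `l`-sorting word `a₁ ⋯ a_k` of `w`, where `a₁ ⋯ a_k` skips
`r` in position `i + 1`: the leftmost instance `x` of `r` in `l^∞` outside of the sorting word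
comes after the letters `a₁, …, a_i` and before the remaining ones. -/
def IsSkip {B W : Type*} [Group W] {M : CoxeterMatrix B} (cs : CoxeterSystem M W)
    (l : List B) (w : W) (r : B) (u : List B) : Prop :=
  ∃ p a x, IsSortingWord cs l w p a ∧ IsLeast {y | periodicLetter l y = some r ∧ y ∉ p} x ∧
    u = a.take (p.countP (· < x))

/-- The reflections `a₁ ⋯ a_i r a_i ⋯ a₁` given by the unforced skips (those skips of `r` in position
`i + 1` for which `a₁ ⋯ a_i r` is reduced) of a `c`-sorting word of `w`. -/
def ufs {B W : Type*} [Group W] {M : CoxeterMatrix B} (cs : CoxeterSystem M W) (c w : W) : Set W :=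
  {t | ∃ l r u, IsCoxeterWord cs c l ∧ IsSkip cs l w r u ∧ cs.IsReduced (u ++ [r]) ∧
    t = cs.wordProd u * cs.simple r * (cs.wordProd u)⁻¹}

/-! ### The recursively defined map and cones -/

open Classical in
/-- The projection `π↓^c` for the Coxeter element `c` with reduced word `l`. If `l = s :: l'`, then
`s` is initial in `c`, `scs` has the reduced word `l' ++ [s]`, and `sc` is the Coxeter element with
reduced word `l'` of the standard parabolic subgroup generated by the letters of `l'`.
The relation `w ≥ s` in the right weak order means that `s` is a left descent of `w`. -/
noncomputable def piDown {B W : Type*} [Group W] {M : CoxeterMatrix B} (cs : CoxeterSystem M W) :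
    List B → W → W
  | [], _ => 1
  | s :: l, w =>
    if _h : cs.IsLeftDescent w s then cs.simple s * piDown cs (l ++ [s]) (cs.simple s * w)
    else piDown cs l (parabolicPart cs {i | i ∈ l} w)
termination_by l w => (l.length, cs.length w)
decreasing_by
  · have : (l ++ [s]).length = (s :: l).length := by simp
    rw [this]
    exact Prod.Lex.right _ _h
  · exact Prod.Lex.left _ _ (by simp)

open Classical in
/-- The root `C_c^r(v)` for the Coxeter element `c` with reduced word `l`, by the same recursion on
`l` as for `piDown`. (It is meaningful if `r` is a letter of `l` and `v` is a `c`-sortable element of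
the subgroup generated by the letters of `l`.) -/
noncomputable def coneRoot {B W : Type*} [Group W] {M : CoxeterMatrix B} (cs : CoxeterSystem M W)
    {A : Matrix B B ℝ} (hA : IsGeneralizedCartan M A) : List B → W → B → (B →₀ ℝ)
  | [], _, _ => 0
  | s :: l, v, r =>
    if _h : cs.IsLeftDescent v s then
      reflRep cs hA (cs.simple s) (coneRoot cs hA (l ++ [s]) (cs.simple s * v) r)
    else if r = s then simpleRoot s
    else coneRoot cs hA l v r
termination_by l v => (l.length, cs.length v)
decreasing_by
  · have : (l ++ [s]).length = (s :: l).length := by simp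
    rw [this]
    exact Prod.Lex.right _ _h
  · exact Prod.Lex.left _ _ (by simp)

/-- The Cambrian cone `Cone_c(v)` for the Coxeter element `c` with reduced word `l`. -/
def cambrianCone {B W : Type*} [Group W] {M : CoxeterMatrix B} (cs : CoxeterSystem M W)
    {A : Matrix B B ℝ} (hA : IsGeneralizedCartan M A) (l : List B) (v : W) :
    Set (Module.Dual ℝ (B →₀ ℝ)) :=
  {x | ∀ r, 0 ≤ x (coneRoot cs hA l v r)}

end Cambrian

/-! Everything follows from one description of the fibres: for sortable `v`, the projection of `w`
is `v` exactly when `w⁻¹` sends every root C^r_c(v) to a nonnegative vector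
(`SortableRec.piDown_eq_iff`). The recursions for the projection and for the roots C^r_c(v) run in
parallel, so induction settles the cases where `v` and `w` agree on lying above the initial letter
`s`. If `w ≥ s` and `v ≱ s`, both sides fail: C^s_c(v) is α_s, and inversions of the projection of
`sw` are inversions of `sw`, so prefixing `s` to that projection gives an element above `s`. If `v ≥
s` and `w ≱ s`, the projection of `w` lies in the parabolic subgroup omitting `s`, so it is not `v`;
that the positivity condition also fails is the main point. It says that -α_s is a nonnegative
combination of the C^r_c(v); equivalently, for the rotated word, in which `s` is final, α_s is a
nonnegative combination of the cone roots of `sv` (`SortableRec.exists_simpleRoot_eq_sum`).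

This sign statement comes from the Euler form E_c(x, y) = Σ_i δ_i x_i y_i + Σ δ_i a_ij x_i y_j, the
second sum over `i` before `j` in the word. It satisfies E_{scs}(sx, sy) = E_c(x, y)
(`eulerForm_rotate`). Hence the functionals dual to the C^r_c(v) can be followed through the
recursion: each is a coordinate, or -κ E_c(β, ·) with κ > 0 and β an inversion of `v`
(`SortableRec.exists_coefficients`). For `s` final, -E(β, α_s) is δ_s times the α_s-coordinate of
sβ, which is nonnegative since sβ is positive unless β is proportional to α_s.

For part 1, C^r_c(v) is the image of α_r under the prefix of the sorting word before the first skip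
of `r` (`SortableRec.reflRep_take_eq_coneRoot`), and the skip is unforced exactly when this root is
positive. A negative cone root equals v α_r (`SortableRec.inv_coneRoot_eq_of_nonpos`), so its
reflection is a cover reflection, and every cover reflection arises up to scaling
(`SortableRec.exists_coneRoot_eq_smul`). Positivity under `w⁻¹` thus reads: covers of `v` are
inversions of `w`, unforced skips are not.

For part 2, the dual functionals show that the cone roots form a basis, and positivity under `w⁻¹`
is dual to wD ⊆ Cone_c(v). A point of the Tits cone in Cone_c(v) is placed in a suitable chamber by
choosing, among the chambers containing it, one nearest to vD (`exists_chamber_subset`). -/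

namespace Cambrian

/-! ### Roots, lengths and inversions for a possibly non-symmetric Cartan matrix. -/

section RootSystem

variable {B W : Type*} [Group W] {M : CoxeterMatrix B} (cs : CoxeterSystem M W)
  {A : Matrix B B ℝ} (hA : IsGeneralizedCartan M A)

/-! ### The reflection representation -/

theorem reflRep_mul (u w : W) (x : B →₀ ℝ) :
    reflRep cs hA (u * w) x = reflRep cs hA u (reflRep cs hA w x) := by
  rw [map_mul, Module.End.mul_apply]

theorem reflRep_one (x : B →₀ ℝ) : reflRep cs hA 1 x = x := by
  rw [map_one, Module.End.one_apply]

theorem reflRep_simple (i : B) (x : B →₀ ℝ) :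
    reflRep cs hA (cs.simple i) x = x - corootFunctional A i x • simpleRoot i := by
  rw [reflRep, MonoidHom.comp_apply, cs.lift_apply_simple]
  exact Module.reflection_apply _ (corootFunctional_self hA i)

theorem reflRep_simple_self (i : B) :
    reflRep cs hA (cs.simple i) (simpleRoot i) = -simpleRoot i := by
  rw [reflRep_simple, corootFunctional_self hA, two_smul]; abel

theorem reflRep_simple_simple (i : B) (x : B →₀ ℝ) :
    reflRep cs hA (cs.simple i) (reflRep cs hA (cs.simple i) x) = x := by
  rw [← reflRep_mul, cs.simple_mul_simple_self, reflRep_one]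

theorem reflRep_inv_reflRep (w : W) (x : B →₀ ℝ) :
    reflRep cs hA w⁻¹ (reflRep cs hA w x) = x := by
  rw [← reflRep_mul, inv_mul_cancel, reflRep_one]

theorem reflRep_reflRep_inv (w : W) (x : B →₀ ℝ) :
    reflRep cs hA w (reflRep cs hA w⁻¹ x) = x := by
  rw [← reflRep_mul, mul_inv_cancel, reflRep_one]

theorem reflRep_injective (w : W) : Function.Injective (reflRep cs hA w) :=
  Function.LeftInverse.injective (reflRep_inv_reflRep cs hA w)

theorem reflRep_inv_simple_mul (i : B) (w : W) (x : B →₀ ℝ) :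
    reflRep cs hA (cs.simple i * w)⁻¹ x =
      reflRep cs hA w⁻¹ (reflRep cs hA (cs.simple i) x) := by
  rw [mul_inv_rev, cs.inv_simple, reflRep_mul]

theorem simpleRoot_apply_self (i : B) : simpleRoot i i = 1 := by
  classical
  simp [simpleRoot]

theorem simpleRoot_apply_of_ne {i j : B} (h : i ≠ j) : simpleRoot i j = 0 := by
  classical
  simp [simpleRoot, h]

theorem simpleRoot_nonneg (i : B) : 0 ≤ simpleRoot i := by
  classical
  simp [simpleRoot]

theorem simpleRoot_ne_zero (i : B) : simpleRoot i ≠ 0 := by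
  simp [simpleRoot]

theorem reflRep_simple_apply_of_ne {i j : B} (h : i ≠ j) (x : B →₀ ℝ) :
    reflRep cs hA (cs.simple i) x j = x j := by
  rw [reflRep_simple, Finsupp.sub_apply, Finsupp.smul_apply, simpleRoot_apply_of_ne h, smul_zero,
    sub_zero]

theorem reflRep_simple_apply_self (i : B) (x : B →₀ ℝ) :
    reflRep cs hA (cs.simple i) x i = x i - corootFunctional A i x := by
  rw [reflRep_simple, Finsupp.sub_apply, Finsupp.smul_apply, simpleRoot_apply_self, smul_eq_mul,
    mul_one]

theorem eq_smul_simpleRoot {i : B} {x : B →₀ ℝ} (h : ∀ j, i ≠ j → x j = 0) :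
    x = x i • simpleRoot i := by
  ext j
  rcases eq_or_ne i j with rfl | hj
  · simp [simpleRoot_apply_self]
  · simp [h j hj, simpleRoot_apply_of_ne hj]

/-- A nonnegative vector that a simple reflection makes nonpositive is a multiple of the
corresponding simple root. -/
theorem eq_smul_simpleRoot_of_nonneg_of_nonpos {i : B} {x : B →₀ ℝ} (hx : 0 ≤ x)
    (hs : reflRep cs hA (cs.simple i) x ≤ 0) : x = x i • simpleRoot i := by
  refine eq_smul_simpleRoot fun j hj => le_antisymm ?_ (hx j)
  have := hs j
  rwa [reflRep_simple_apply_of_ne cs hA hj] at this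

/-! ### Dihedral computations -/

theorem chebyshev_S_eval_nonneg_of_two_le {u : ℝ} (hu : 2 ≤ u) (n : ℕ) :
    0 ≤ (Polynomial.Chebyshev.S ℝ ((n : ℤ) - 1)).eval u := by
  -- The recursion S_{n+1} = u S_n - S_{n-1} with u ≥ 2 propagates nonnegativity only together with
  -- monotonicity.
  have key : ∀ n : ℕ, 0 ≤ (Polynomial.Chebyshev.S ℝ ((n : ℤ) - 1)).eval u ∧
      (Polynomial.Chebyshev.S ℝ ((n : ℤ) - 1)).eval u ≤
        (Polynomial.Chebyshev.S ℝ (n : ℤ)).eval u := by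
    intro n
    induction n with
    | zero => simp
    | succ n ih =>
      have h := Polynomial.Chebyshev.S_add_one ℝ (n : ℤ)
      obtain ⟨h0, h1⟩ := ih
      push_cast
      rw [h, add_sub_cancel_right]
      refine ⟨h0.trans h1, ?_⟩
      simp only [Polynomial.eval_sub, Polynomial.eval_mul, Polynomial.eval_X]
      nlinarith
  exact (key n).1

/-- S_{n-1}(2 cos θ) sin θ = sin nθ, and nθ ≤ π for θ = π/m and n ≤ m. -/
theorem chebyshev_S_eval_nonneg_of_le {m n : ℕ} (hm : 2 ≤ m) (hn : n ≤ m) :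
    0 ≤ (Polynomial.Chebyshev.S ℝ ((n : ℤ) - 1)).eval (2 * Real.cos (Real.pi / m)) := by
  have h := Polynomial.Chebyshev.S_two_mul_real_cos (Real.pi / m) ((n : ℤ) - 1)
  have hm' : (2 : ℝ) ≤ m := by exact_mod_cast hm
  have hn' : (n : ℝ) ≤ m := by exact_mod_cast hn
  have hpi := Real.pi_pos
  have hs : 0 < Real.sin (Real.pi / m) := by
    apply Real.sin_pos_of_pos_of_lt_pi (by positivity)
    rw [div_lt_iff₀ (by linarith)]; nlinarith
  have hs' : 0 ≤ Real.sin ((((n : ℤ) - 1 : ℤ) + 1 : ℝ) * (Real.pi / m)) := by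
    have : ((((n : ℤ) - 1 : ℤ) + 1 : ℝ) * (Real.pi / m)) = n * Real.pi / m := by
      push_cast; ring
    rw [this]
    apply Real.sin_nonneg_of_nonneg_of_le_pi (by positivity)
    rw [div_le_iff₀ (by linarith)]; nlinarith
  rw [← h] at hs'
  exact nonneg_of_mul_nonneg_left hs' hs

include hA in
-- The parameter `u` is the geometric mean of -a_ij and -a_ji: it is 2 cos(π/m) for finite m and at
-- least 2 otherwise. This treats finite and infinite dihedral subgroups uniformly.
theorem exists_dihedral_parameter {i j : B} (hij : i ≠ j) :
    ∃ u : ℝ, 0 ≤ u ∧ u * u = A i j * A j i ∧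
      ∀ n : ℕ, (M i j = 0 ∨ n ≤ M i j) →
        0 ≤ (Polynomial.Chebyshev.S ℝ ((n : ℤ) - 1)).eval u := by
  rcases eq_or_ne (M i j) 0 with h0 | h0
  · have h4 := hA.mul_ge i j h0
    refine ⟨√(A i j * A j i), Real.sqrt_nonneg _, Real.mul_self_sqrt (by linarith), fun n _ => ?_⟩
    apply chebyshev_S_eval_nonneg_of_two_le
    rw [show (2 : ℝ) = √4 by rw [show (4 : ℝ) = 2 ^ 2 by norm_num]; simp]
    exact Real.sqrt_le_sqrt h4
  · have h1 : M i j ≠ 1 := M.off_diagonal i j hij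
    have hm : 2 ≤ M i j := by omega
    have hm' : (2 : ℝ) ≤ M i j := by exact_mod_cast hm
    refine ⟨2 * Real.cos (Real.pi / M i j), ?_, ?_, fun n hn => ?_⟩
    · have hpi := Real.pi_pos
      have : 0 ≤ Real.cos (Real.pi / M i j) := by
        apply Real.cos_nonneg_of_neg_pi_div_two_le_of_le
        · have : 0 ≤ Real.pi / M i j := by positivity
          linarith
        · apply div_le_div_of_nonneg_left hpi.le (by norm_num) hm'
      linarith
    · rw [hA.mul_eq i j hij h0]; ring
    · exact chebyshev_S_eval_nonneg_of_le hm (hn.resolve_left h0)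

/-- The coordinates along a dihedral orbit obey the three-term recursion of the Chebyshev
polynomials S. The factor `-A j i / u` compensates for the asymmetry of the matrix; if u = 0 both
entries vanish, and the convention x/0 = 0 gives the right value. -/
theorem reflRep_alternatingWord {i j : B} (u : ℝ) (hu : u * u = A i j * A j i) (k : ℕ) :
    reflRep cs hA (cs.wordProd (CoxeterSystem.alternatingWord i j k)) (simpleRoot i) =
      if Even k then
        (Polynomial.Chebyshev.S ℝ (((k + 1 : ℕ) : ℤ) - 1)).eval u • simpleRoot i +
          (-A j i / u * (Polynomial.Chebyshev.S ℝ ((k : ℤ) - 1)).eval u) • simpleRoot j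
      else (Polynomial.Chebyshev.S ℝ ((k : ℤ) - 1)).eval u • simpleRoot i +
          (-A j i / u * (Polynomial.Chebyshev.S ℝ (((k + 1 : ℕ) : ℤ) - 1)).eval u) •
            simpleRoot j := by
  have hu1 : -A j i / u * u = -A j i := by
    rcases eq_or_ne u 0 with rfl | h
    · have : A j i = 0 := by
        rcases mul_eq_zero.mp (hu.symm.trans (mul_zero 0)) with h | h
        · exact (hA.zero_iff i j).mp h
        · exact h
      simp [this]
    · field_simp
  have hu2 : A i j * (-A j i / u) = - u := by
    rcases eq_or_ne u 0 with rfl | h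
    · simp
    · field_simp; linarith
  induction k with
  | zero =>
    simp [CoxeterSystem.alternatingWord]
  | succ k ih =>
    have hrec := congrArg (Polynomial.eval u) (Polynomial.Chebyshev.S_add_one ℝ (k : ℤ))
    simp only [Polynomial.eval_sub, Polynomial.eval_mul, Polynomial.eval_X] at hrec
    have e1 : (((k + 1 : ℕ) : ℤ) - 1) = k := by push_cast; ring
    have e2 : (((k + 1 + 1 : ℕ) : ℤ) - 1) = k + 1 := by push_cast; ring
    rw [CoxeterSystem.alternatingWord_succ', cs.wordProd_cons, reflRep_mul, ih, e1, e2, hrec]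
    by_cases hk : Even k
    · simp only [hk, if_true, Nat.even_add_one, not_true, if_false, map_add, map_smul,
        reflRep_simple_simpleRoot, hA.diag]
      ext b
      simp only [Finsupp.add_apply, Finsupp.smul_apply, Finsupp.sub_apply, smul_eq_mul]
      linear_combination -((Polynomial.Chebyshev.S ℝ (k : ℤ)).eval u) * simpleRoot j b * hu1
    · simp only [hk, if_false, Nat.even_add_one, not_false_eq_true, if_true, map_add, map_smul,
        reflRep_simple_simpleRoot, hA.diag]
      ext b
      simp only [Finsupp.add_apply, Finsupp.smul_apply, Finsupp.sub_apply, smul_eq_mul]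
      linear_combination -((Polynomial.Chebyshev.S ℝ (k : ℤ)).eval u) * simpleRoot i b * hu2

theorem reflRep_alternatingWord_eq_add {i j : B} (hij : i ≠ j) {k : ℕ}
    (hk : M i j = 0 ∨ k < M i j) :
    ∃ x y : ℝ, 0 ≤ x ∧ 0 ≤ y ∧
      reflRep cs hA (cs.wordProd (CoxeterSystem.alternatingWord i j k)) (simpleRoot i) =
        x • simpleRoot i + y • simpleRoot j := by
  obtain ⟨u, hu0, hu, hS⟩ := exists_dihedral_parameter hA hij
  have hμ : 0 ≤ -A j i / u := div_nonneg (by linarith [hA.nonpos j i hij.symm]) hu0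
  have h1 := hS k (hk.imp_right le_of_lt)
  have h2 := hS (k + 1) hk
  rw [reflRep_alternatingWord cs hA u hu k]
  split_ifs
  · exact ⟨_, _, h2, mul_nonneg hμ h1, rfl⟩
  · exact ⟨_, _, h1, mul_nonneg hμ h2, rfl⟩

/-! ### Roots are positive or negative -/

theorem length_mul_wordProd_le (v : W) (a : List B) :
    cs.length (v * cs.wordProd a) ≤ cs.length v + a.length :=
  (cs.length_mul_le _ _).trans (Nat.add_le_add_left (cs.length_wordProd_le a) _)

/-- Choose the longest alternating suffix, ending in `j`, that can be split off with additive
length. A descent of `v` at the letter continuing the alternation would lengthen the suffix; a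
descent at the letter where the suffix begins would cancel and shorten `w`. -/
theorem exists_alternatingWord_factor {w : W} {i j : B} (hj : cs.IsRightDescent w j) :
    ∃ v k, w = v * cs.wordProd (CoxeterSystem.alternatingWord i j k) ∧
      cs.length v + k = cs.length w ∧ 0 < k ∧
      ¬ cs.IsRightDescent v i ∧ ¬ cs.IsRightDescent v j := by
  classical
  let P : ℕ → Prop := fun k => ∃ v, w = v * cs.wordProd (CoxeterSystem.alternatingWord i j k) ∧
    cs.length v + k = cs.length w
  have hP1 : P 1 := by
    refine ⟨w * cs.simple j, ?_, cs.isRightDescent_iff.mp hj⟩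
    simp [CoxeterSystem.alternatingWord]
  have hle : ∀ k, P k → k ≤ cs.length w := fun k ⟨v, _, h⟩ => by omega
  set k := Nat.findGreatest P (cs.length w) with hkdef
  have h1k : 1 ≤ k := Nat.le_findGreatest (hle 1 hP1) hP1
  obtain ⟨v, hv, hlen⟩ : P k := Nat.findGreatest_spec (hle 1 hP1) hP1
  have hmax : ¬ P (k + 1) := fun h =>
    absurd (Nat.le_findGreatest (hle _ h) h) (by omega)
  have hnext : ¬ cs.IsRightDescent v (if Even k then j else i) := by
    intro hd
    apply hmax
    refine ⟨v * cs.simple (if Even k then j else i), ?_, ?_⟩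
    · rw [CoxeterSystem.alternatingWord_succ', cs.wordProd_cons, ← mul_assoc,
        cs.simple_mul_simple_cancel_right]
      exact hv
    · rw [← hlen, ← cs.isRightDescent_iff.mp hd]; ring
  have hprev : ¬ cs.IsRightDescent v (if Even k then i else j) := by
    intro hd
    obtain ⟨k', hk'⟩ : ∃ k', k = k' + 1 := ⟨k - 1, by omega⟩
    have hq : (if Even k then i else j) = if Even k' then j else i := by
      simp only [hk', Nat.even_add_one, ite_not]
    have hw : w = v * cs.simple (if Even k then i else j) *
        cs.wordProd (CoxeterSystem.alternatingWord i j k') := by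
      conv_lhs => rw [hv, hk', CoxeterSystem.alternatingWord_succ', cs.wordProd_cons]
      rw [hq, mul_assoc]
    have h1 := length_mul_wordProd_le cs (v * cs.simple (if Even k then i else j))
      (CoxeterSystem.alternatingWord i j k')
    rw [← hw, CoxeterSystem.length_alternatingWord] at h1
    have h2 := cs.isRightDescent_iff.mp hd
    omega
  refine ⟨v, k, hv, hlen, h1k, ?_⟩
  by_cases hk : Even k
  · simp only [hk, if_true] at hnext hprev
    exact ⟨hprev, hnext⟩
  · simp only [hk, if_false] at hnext hprev
    exact ⟨hnext, hprev⟩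

/-- Induction on length: with a descent `j` of `w`, write w = v d with d alternating in `i`, `j`.
The dihedral computation makes d α_i a nonnegative combination of α_i and α_j, and the shorter `v`
has neither letter as a descent. -/
theorem reflRep_simpleRoot_nonneg {w : W} {i : B} (hi : ¬ cs.IsRightDescent w i) :
    0 ≤ reflRep cs hA w (simpleRoot i) := by
  induction hn : cs.length w using Nat.strong_induction_on generalizing w i with
  | _ n ih =>
    subst hn
    rcases eq_or_ne w 1 with rfl | hw
    · rw [reflRep_one]; exact simpleRoot_nonneg i
    obtain ⟨j, hj⟩ := cs.exists_rightDescent_of_ne_one hw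
    have hij : i ≠ j := fun h => hi (h ▸ hj)
    obtain ⟨v, k, hv, hlen, hk, hvi, hvj⟩ := exists_alternatingWord_factor cs (i := i) hj
    -- Otherwise `w s_i`, which is longer than `w`, would be `v` times an alternating word of length
    -- k + 1 > m, which is not reduced.
    have hkm : M i j = 0 ∨ k < M i j := by
      by_contra! h
      obtain ⟨h0, hle⟩ := h
      have hsym : M j i = M i j := M.symmetric j i
      have h1 := cs.not_isReduced_alternatingWord j i (m := k + 1) (by rwa [hsym])
        (by rw [hsym]; omega)
      have h2 := cs.not_isRightDescent_iff.mp hi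
      rw [hv, mul_assoc, ← cs.wordProd_concat, ← CoxeterSystem.alternatingWord_succ, ← hv] at h2
      have h3 := cs.length_mul_le v (cs.wordProd (CoxeterSystem.alternatingWord j i (k + 1)))
      have h4 := cs.length_wordProd_le (CoxeterSystem.alternatingWord j i (k + 1))
      rw [CoxeterSystem.IsReduced] at h1
      rw [CoxeterSystem.length_alternatingWord] at h1 h4
      omega
    obtain ⟨x, y, hx, hy, hxy⟩ := reflRep_alternatingWord_eq_add cs hA hij hkm
    rw [hv, reflRep_mul, hxy, map_add, map_smul, map_smul]
    exact add_nonneg (smul_nonneg hx (ih _ (by omega) hvi rfl))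
      (smul_nonneg hy (ih _ (by omega) hvj rfl))

theorem reflRep_simpleRoot_nonpos {w : W} {i : B} (hi : cs.IsRightDescent w i) :
    reflRep cs hA w (simpleRoot i) ≤ 0 := by
  have h := reflRep_simpleRoot_nonneg cs hA (cs.isRightDescent_iff_not_isRightDescent_mul.mp hi)
  rw [reflRep_mul, reflRep_simple_self, map_neg] at h
  exact neg_nonneg.mp h

/-- The elements of the orbits of the simple roots. -/
def IsRoot (β : B →₀ ℝ) : Prop := ∃ y r, β = reflRep cs hA y (simpleRoot r)

variable {cs hA}

theorem isRoot_simpleRoot (i : B) : IsRoot cs hA (simpleRoot i) := ⟨1, i, by rw [reflRep_one]⟩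

theorem IsRoot.map {β : B →₀ ℝ} (h : IsRoot cs hA β) (w : W) :
    IsRoot cs hA (reflRep cs hA w β) := by
  obtain ⟨y, r, rfl⟩ := h
  exact ⟨w * y, r, by rw [reflRep_mul]⟩

theorem IsRoot.nonneg_or_nonpos {β : B →₀ ℝ} (h : IsRoot cs hA β) : 0 ≤ β ∨ β ≤ 0 := by
  obtain ⟨y, r, rfl⟩ := h
  by_cases hd : cs.IsRightDescent y r
  · exact Or.inr (reflRep_simpleRoot_nonpos cs hA hd)
  · exact Or.inl (reflRep_simpleRoot_nonneg cs hA hd)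

theorem IsRoot.ne_zero {β : B →₀ ℝ} (h : IsRoot cs hA β) : β ≠ 0 := by
  obtain ⟨y, r, rfl⟩ := h
  intro h0
  exact simpleRoot_ne_zero r (reflRep_injective cs hA y (h0.trans (map_zero _).symm))

theorem IsRoot.not_nonneg_iff {β : B →₀ ℝ} (h : IsRoot cs hA β) : ¬ 0 ≤ β ↔ β ≤ 0 :=
  ⟨h.nonneg_or_nonpos.resolve_left, fun h1 h2 => h.ne_zero (le_antisymm h1 h2)⟩

theorem IsRoot.not_nonpos_iff {β : B →₀ ℝ} (h : IsRoot cs hA β) : ¬ β ≤ 0 ↔ 0 ≤ β := by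
  rw [← h.not_nonneg_iff, not_not]

theorem IsRoot.nonneg_of_apply_pos {β : B →₀ ℝ} (h : IsRoot cs hA β) {i : B} (hi : 0 < β i) :
    0 ≤ β :=
  h.nonneg_or_nonpos.resolve_right fun h' => absurd (h' i) (by simpa using hi)

variable (cs hA)

theorem not_isRightDescent_iff_nonneg {w : W} {i : B} :
    ¬ cs.IsRightDescent w i ↔ 0 ≤ reflRep cs hA w (simpleRoot i) :=
  ⟨reflRep_simpleRoot_nonneg cs hA, fun h hd =>
    ((isRoot_simpleRoot i).map w).not_nonneg_iff.mpr (reflRep_simpleRoot_nonpos cs hA hd) h⟩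

theorem isRightDescent_iff_nonpos {w : W} {i : B} :
    cs.IsRightDescent w i ↔ reflRep cs hA w (simpleRoot i) ≤ 0 := by
  rw [← ((isRoot_simpleRoot i).map w).not_nonneg_iff, ← not_isRightDescent_iff_nonneg, not_not]

theorem not_isLeftDescent_iff_nonneg {w : W} {i : B} :
    ¬ cs.IsLeftDescent w i ↔ 0 ≤ reflRep cs hA w⁻¹ (simpleRoot i) := by
  rw [← not_isRightDescent_iff_nonneg, cs.isRightDescent_inv_iff]

theorem isLeftDescent_iff_nonpos {w : W} {i : B} :
    cs.IsLeftDescent w i ↔ reflRep cs hA w⁻¹ (simpleRoot i) ≤ 0 := by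
  rw [← isRightDescent_iff_nonpos, cs.isRightDescent_inv_iff]

/-- Roots are not normalised: the orbit of a simple root can contain κ α_i with κ ≠ 1, for instance
when m = 3 and a_ij ≠ a_ji. Positive factors are therefore carried along throughout. -/
theorem IsRoot.eq_smul_simpleRoot {i : B} {β : B →₀ ℝ} (h : IsRoot cs hA β) (hβ : 0 ≤ β)
    (hs : reflRep cs hA (cs.simple i) β ≤ 0) : 0 < β i ∧ β = β i • simpleRoot i := by
  have he := eq_smul_simpleRoot_of_nonneg_of_nonpos cs hA hβ hs
  refine ⟨lt_of_le_of_ne (hβ i) fun h0 => h.ne_zero ?_, he⟩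
  rw [he, ← h0, zero_smul]

/-- An element of `W` that sends every simple root to a nonnegative vector is trivial. -/
theorem eq_one_of_forall_nonneg {w : W} (h : ∀ i, 0 ≤ reflRep cs hA w (simpleRoot i)) :
    w = 1 := by
  by_contra hw
  obtain ⟨i, hi⟩ := cs.exists_rightDescent_of_ne_one hw
  exact (not_isRightDescent_iff_nonneg cs hA).mpr (h i) hi

/-! ### Reflections and inversions -/

/-- The element z⁻¹ s_q z s_r fixes α_r and changes any other α_i only in the coordinate at `r`. It
therefore sends α_i to a root with `i`-coordinate 1, hence positive, and an element keeping all
simple roots positive is trivial. -/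
theorem mul_simple_eq_simple_mul {z : W} {r q : B} {κ : ℝ} (hκ : 0 < κ)
    (h : reflRep cs hA z (simpleRoot r) = κ • simpleRoot q) :
    z * cs.simple r = cs.simple q * z := by
  have hz : reflRep cs hA z⁻¹ (simpleRoot q) = κ⁻¹ • simpleRoot r := by
    rw [eq_inv_smul_iff₀ hκ.ne', ← map_smul, ← h, reflRep_inv_reflRep]
  have hg : z⁻¹ * cs.simple q * z * cs.simple r = 1 := by
    apply eq_one_of_forall_nonneg cs hA
    intro i
    have hroot := (isRoot_simpleRoot (cs := cs) (hA := hA) i).map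
      (z⁻¹ * cs.simple q * z * cs.simple r)
    rcases eq_or_ne r i with rfl | hi
    · rw [reflRep_mul, reflRep_simple_self, map_neg, reflRep_mul, h, reflRep_mul, map_smul,
        reflRep_simple_self, map_smul, map_neg, hz, smul_neg, neg_neg, smul_smul,
        mul_inv_cancel₀ hκ.ne', one_smul]
      exact simpleRoot_nonneg r
    · apply hroot.nonneg_of_apply_pos (i := i)
      have e : ∀ x, reflRep cs hA (z⁻¹ * cs.simple q * z) x i = x i := by
        intro x
        rw [reflRep_mul, reflRep_mul, reflRep_simple, map_sub, map_smul, hz, reflRep_inv_reflRep]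
        simp [simpleRoot_apply_of_ne hi]
      rw [reflRep_mul, e, reflRep_simple_apply_of_ne cs hA hi, simpleRoot_apply_self]
      exact one_pos
  have := mul_eq_one_iff_eq_inv.mp hg
  rw [cs.inv_simple, mul_assoc, inv_mul_eq_iff_eq_mul] at this
  exact this.symm

/-- Induction on the length of `w`: for a left descent `q`, conjugate everything by s_q. This fails
only if s_q makes the root negative; then the root is proportional to α_q and the reflection is s_q
itself. -/
theorem length_reflection_mul_lt {y w : W} {r : B} (hy : 0 ≤ reflRep cs hA y (simpleRoot r))
    (hw : reflRep cs hA w⁻¹ (reflRep cs hA y (simpleRoot r)) ≤ 0) :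
    cs.length (y * cs.simple r * y⁻¹ * w) < cs.length w := by
  induction hn : cs.length w using Nat.strong_induction_on generalizing w y with
  | _ n ih =>
    subst hn
    have hroot := (isRoot_simpleRoot (cs := cs) (hA := hA) r).map y
    have hw1 : w ≠ 1 := by
      rintro rfl
      rw [inv_one, reflRep_one] at hw
      exact hroot.not_nonneg_iff.mpr hw hy
    obtain ⟨q, hq⟩ := cs.exists_leftDescent_of_ne_one hw1
    have hlen := cs.isLeftDescent_iff.mp hq
    rcases (hroot.map (cs.simple q)).nonneg_or_nonpos with hs | hs
    · rw [← reflRep_mul] at hs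
      have key := ih (cs.length (cs.simple q * w)) (by omega) (y := cs.simple q * y)
        (w := cs.simple q * w) hs (by
          rw [reflRep_inv_simple_mul, reflRep_mul, reflRep_simple_simple]; exact hw) rfl
      have e : cs.simple q * y * cs.simple r * (cs.simple q * y)⁻¹ * (cs.simple q * w) =
          cs.simple q * (y * cs.simple r * y⁻¹ * w) := by
        rw [mul_inv_rev]; group
      rw [e] at key
      rcases cs.length_simple_mul (y * cs.simple r * y⁻¹ * w) q with h | h <;> omega
    · obtain ⟨hpos, he⟩ := hroot.eq_smul_simpleRoot cs hA hy hs
      have hc := mul_simple_eq_simple_mul cs hA hpos he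
      rw [hc, mul_assoc _ y, mul_inv_cancel, mul_one]
      exact hq

theorem isLeftInversion_iff_nonpos {y w : W} {r : B}
    (hy : 0 ≤ reflRep cs hA y (simpleRoot r)) :
    cs.IsLeftInversion w (y * cs.simple r * y⁻¹) ↔
      reflRep cs hA w⁻¹ (reflRep cs hA y (simpleRoot r)) ≤ 0 := by
  have hrefl : cs.IsReflection (y * cs.simple r * y⁻¹) := ⟨y, r, rfl⟩
  refine ⟨fun h => ?_, fun h => ⟨hrefl, length_reflection_mul_lt cs hA hy h⟩⟩
  by_contra hneg
  have hroot := (isRoot_simpleRoot (cs := cs) (hA := hA) r).map y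
  have h1 := (hroot.map w⁻¹).not_nonpos_iff.mp hneg
  have h2 := length_reflection_mul_lt cs hA (w := y * cs.simple r * y⁻¹ * w) hy (by
    have e : (y * cs.simple r * y⁻¹ * w)⁻¹ = w⁻¹ * (y * (cs.simple r * y⁻¹)) := by
      simp [mul_assoc]
    rw [e, reflRep_mul, reflRep_mul, reflRep_mul, reflRep_inv_reflRep, reflRep_simple_self,
      map_neg, map_neg]
    exact neg_nonpos.mpr h1)
  rw [← mul_assoc, hrefl.mul_self, one_mul] at h2
  exact absurd h.2 (by omega)

/-! ### Standard parabolic subgroups -/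

/-- Invariance of the coordinates outside `J` is the main device for proving that a root is positive
or lies in a parabolic span. -/
theorem reflRep_apply_of_notMem {J : Set B} {u : W} (hu : u ∈ parabolic cs J) {i : B}
    (hi : i ∉ J) (x : B →₀ ℝ) : reflRep cs hA u x i = x i := by
  induction hu using Subgroup.closure_induction generalizing x with
  | mem g hg =>
    obtain ⟨j, hj, rfl⟩ := hg
    exact reflRep_simple_apply_of_ne cs hA (ne_of_mem_of_not_mem hj hi) x
  | one => rw [reflRep_one]
  | mul g h _ _ ihg ihh => rw [reflRep_mul, ihg, ihh]
  | inv g _ ih => rw [← ih (reflRep cs hA g⁻¹ x), reflRep_reflRep_inv]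

theorem reflRep_mem_supported {J : Set B} {u : W} (hu : u ∈ parabolic cs J) {x : B →₀ ℝ}
    (hx : x ∈ Finsupp.supported ℝ ℝ J) : reflRep cs hA u x ∈ Finsupp.supported ℝ ℝ J := by
  rw [Finsupp.mem_supported'] at hx ⊢
  intro i hi
  rw [reflRep_apply_of_notMem cs hA hu hi, hx i hi]

theorem simple_mem_parabolic {J : Set B} {j : B} (hj : j ∈ J) : cs.simple j ∈ parabolic cs J :=
  Subgroup.subset_closure ⟨j, hj, rfl⟩

theorem parabolic_mono {J K : Set B} (h : J ⊆ K) : parabolic cs J ≤ parabolic cs K :=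
  Subgroup.closure_mono (Set.image_mono h)

theorem simpleRoot_mem_supported {J : Set B} {j : B} (hj : j ∈ J) :
    simpleRoot j ∈ Finsupp.supported ℝ ℝ J :=
  Finsupp.single_mem_supported ℝ 1 hj

theorem not_isLeftDescent_of_mem_parabolic {J : Set B} {u : W} (hu : u ∈ parabolic cs J) {i : B}
    (hi : i ∉ J) (hA : IsGeneralizedCartan M A) : ¬ cs.IsLeftDescent u i := by
  rw [not_isLeftDescent_iff_nonneg cs hA]
  apply ((isRoot_simpleRoot i).map _).nonneg_of_apply_pos (i := i)
  rw [reflRep_apply_of_notMem cs hA (inv_mem hu) hi, simpleRoot_apply_self]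
  exact one_pos

theorem nonneg_reflRep_of_forall_simpleRoot {J : Set B} {m : W}
    (hm : ∀ j ∈ J, 0 ≤ reflRep cs hA m (simpleRoot j)) {x : B →₀ ℝ}
    (hx : x ∈ Finsupp.supported ℝ ℝ J) (h0 : 0 ≤ x) : 0 ≤ reflRep cs hA m x := by
  have e : x = x.sum fun i a => a • simpleRoot i := by
    simp [simpleRoot, Finsupp.sum_single]
  rw [e, Finsupp.sum, map_sum]
  refine Finset.sum_nonneg fun i hi => ?_
  rw [map_smul]
  exact smul_nonneg (h0 i) (hm i (hx hi))

theorem mul_inv_minCosetRep_mem (J : Set B) (w : W) : parabolicPart cs J w ∈ parabolic cs J :=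
  Function.argminOn_mem cs.length {x | w * x⁻¹ ∈ parabolic cs J} _

theorem not_isLeftDescent_minCosetRep {J : Set B} (w : W) {j : B} (hj : j ∈ J) :
    ¬ cs.IsLeftDescent (minCosetRep cs J w) j := by
  refine not_lt.mpr (Function.argminOn_le cs.length {x | w * x⁻¹ ∈ parabolic cs J} ?_)
  rw [Set.mem_ofPred_eq, mul_inv_rev, ← mul_assoc, cs.inv_simple]
  exact mul_mem (mul_inv_minCosetRep_mem cs J w) (simple_mem_parabolic cs hj)

/-- The inverse of the minimal coset representative keeps the simple roots of `J` nonnegative, hence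
also their nonnegative combinations. -/
theorem reflRep_inv_nonneg_of_parabolicPart {J : Set B} {w : W} {x : B →₀ ℝ}
    (hx : x ∈ Finsupp.supported ℝ ℝ J)
    (h : 0 ≤ reflRep cs hA (parabolicPart cs J w)⁻¹ x) : 0 ≤ reflRep cs hA w⁻¹ x := by
  have e : w⁻¹ = (minCosetRep cs J w)⁻¹ * (parabolicPart cs J w)⁻¹ := by
    simp [parabolicPart]
  rw [e, reflRep_mul]
  refine nonneg_reflRep_of_forall_simpleRoot cs hA (fun j hj => ?_)
    (reflRep_mem_supported cs hA (inv_mem (mul_inv_minCosetRep_mem cs J w)) hx) h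
  exact (not_isLeftDescent_iff_nonneg cs hA).mp (not_isLeftDescent_minCosetRep cs w hj)

theorem IsRoot.reflRep_parabolicPart_inv_nonneg_iff {J : Set B} {w : W} {β : B →₀ ℝ}
    (hβ : IsRoot cs hA β) (hx : β ∈ Finsupp.supported ℝ ℝ J) :
    0 ≤ reflRep cs hA (parabolicPart cs J w)⁻¹ β ↔
      0 ≤ reflRep cs hA w⁻¹ β := by
  refine ⟨reflRep_inv_nonneg_of_parabolicPart cs hA hx, fun h => ?_⟩
  rw [← (hβ.map _).not_nonpos_iff]
  intro hn
  have h' := reflRep_inv_nonneg_of_parabolicPart cs hA (w := w) (neg_mem hx)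
    (by rw [map_neg]; exact neg_nonneg.mpr hn)
  rw [map_neg] at h'
  exact (hβ.map _).not_nonneg_iff.mpr (neg_nonneg.mp h') h

end RootSystem


/-! ### Cone roots, the Euler form and the fibres of the projection. -/

section SortableRecursion

variable {B W : Type*} [Group W] {M : CoxeterMatrix B} (cs : CoxeterSystem M W)
  {A : Matrix B B ℝ} (hA : IsGeneralizedCartan M A)

/-! ### Rotating a word -/

theorem mem_rotate_iff {s r : B} {l : List B} : r ∈ l ++ [s] ↔ r ∈ s :: l :=
  (List.perm_append_singleton s l).mem_iff

theorem nodup_rotate {s : B} {l : List B} (h : (s :: l).Nodup) : (l ++ [s]).Nodup :=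
  (List.perm_append_singleton s l).nodup_iff.mpr h

theorem letters_rotate (s : B) (l : List B) : {i | i ∈ l ++ [s]} = {i | i ∈ s :: l} :=
  Set.ext fun _ => mem_rotate_iff

theorem letters_subset_cons (s : B) (l : List B) : {i | i ∈ l} ⊆ {i | i ∈ s :: l} :=
  fun _ h => List.mem_cons_of_mem s h

theorem sum_map_rotate {V : Type*} [AddCommMonoid V] (s : B) (l : List B) (f : B → V) :
    ((l ++ [s]).map f).sum = ((s :: l).map f).sum :=
  ((List.perm_append_singleton s l).map f).sum_eq

/-- The span of the simple roots of the letters of a word. -/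
abbrev letterSpan (l : List B) : Submodule ℝ (B →₀ ℝ) := Finsupp.supported ℝ ℝ {i | i ∈ l}

theorem letterSpan_rotate (s : B) (l : List B) : letterSpan (l ++ [s]) = letterSpan (s :: l) := by
  rw [letterSpan, letters_rotate]

theorem letterSpan_le_cons (s : B) (l : List B) : letterSpan l ≤ letterSpan (s :: l) :=
  Finsupp.supported_mono (letters_subset_cons s l)

theorem apply_eq_zero_of_mem_letterSpan {l : List B} {x : B →₀ ℝ} (hx : x ∈ letterSpan l) {i : B}
    (hi : i ∉ l) : x i = 0 :=
  (Finsupp.mem_supported' ℝ x).mp hx i hi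

theorem simple_mem_letterSpan {s : B} {l : List B} {x : B →₀ ℝ} (hx : x ∈ letterSpan (s :: l)) :
    reflRep cs hA (cs.simple s) x ∈ letterSpan (s :: l) :=
  reflRep_mem_supported cs hA (simple_mem_parabolic cs List.mem_cons_self) hx

/-! ### Recursive description of sortable elements -/

/-- The recursive form of sortability: `v` is sortable with respect to the Coxeter element with
reduced word `s :: l` if either `v ≥ s` and `s v` is sortable for the rotated word, or `v` is
sortable in the parabolic subgroup generated by the letters of `l`. -/
inductive SortableRec : List B → W → Prop
  | nil : SortableRec [] 1
  | step {s : B} {l : List B} {v : W} (h : cs.IsLeftDescent v s)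
      (hv : SortableRec (l ++ [s]) (cs.simple s * v)) : SortableRec (s :: l) v
  | drop {s : B} {l : List B} {v : W} (h : ¬ cs.IsLeftDescent v s)
      (hv : SortableRec l v) : SortableRec (s :: l) v

variable {cs}

theorem SortableRec.mem_parabolic {l : List B} {v : W} (h : SortableRec cs l v) :
    v ∈ parabolic cs {i | i ∈ l} := by
  induction h with
  | nil => exact one_mem _
  | @step s l v _ _ ih =>
    rw [letters_rotate] at ih
    have := mul_mem (simple_mem_parabolic cs (J := {i | i ∈ s :: l}) List.mem_cons_self) ih
    rwa [cs.simple_mul_simple_cancel_left] at this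
  | drop _ _ ih => exact parabolic_mono cs (letters_subset_cons _ _) ih

variable (cs)

theorem sortableRec_nil_iff {v : W} : SortableRec cs [] v ↔ v = 1 :=
  ⟨fun h => by cases h; rfl, fun h => h ▸ .nil⟩

theorem sortableRec_cons_of_isLeftDescent {s : B} {l : List B} {v : W}
    (h : cs.IsLeftDescent v s) :
    SortableRec cs (s :: l) v ↔ SortableRec cs (l ++ [s]) (cs.simple s * v) := by
  refine ⟨fun hv => ?_, .step h⟩
  cases hv with
  | step _ hv => exact hv
  | drop h' _ => exact absurd h h'

theorem sortableRec_cons_of_not_isLeftDescent {s : B} {l : List B} {v : W}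
    (h : ¬ cs.IsLeftDescent v s) : SortableRec cs (s :: l) v ↔ SortableRec cs l v := by
  refine ⟨fun hv => ?_, .drop h⟩
  cases hv with
  | step h' _ => exact absurd h' h
  | drop _ hv => exact hv

theorem coneRoot_of_isLeftDescent {s : B} {l : List B} {v : W} (h : cs.IsLeftDescent v s) (r : B) :
    coneRoot cs hA (s :: l) v r =
      reflRep cs hA (cs.simple s) (coneRoot cs hA (l ++ [s]) (cs.simple s * v) r) := by
  rw [coneRoot, dif_pos h]

theorem coneRoot_self_of_not_isLeftDescent {s : B} {l : List B} {v : W}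
    (h : ¬ cs.IsLeftDescent v s) : coneRoot cs hA (s :: l) v s = simpleRoot s := by
  rw [coneRoot, dif_neg h, if_pos rfl]

theorem coneRoot_of_not_isLeftDescent {s r : B} {l : List B} {v : W}
    (h : ¬ cs.IsLeftDescent v s) (hr : r ≠ s) :
    coneRoot cs hA (s :: l) v r = coneRoot cs hA l v r := by
  rw [coneRoot, dif_neg h, if_neg hr]

theorem piDown_nil (w : W) : piDown cs [] w = 1 := by rw [piDown]

theorem piDown_of_isLeftDescent {s : B} {l : List B} {w : W} (h : cs.IsLeftDescent w s) :
    piDown cs (s :: l) w = cs.simple s * piDown cs (l ++ [s]) (cs.simple s * w) := by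
  rw [piDown, dif_pos h]

theorem piDown_of_not_isLeftDescent {s : B} {l : List B} {w : W} (h : ¬ cs.IsLeftDescent w s) :
    piDown cs (s :: l) w = piDown cs l (parabolicPart cs {i | i ∈ l} w) := by
  rw [piDown, dif_neg h]

/-- Induction along the recursion on a word and an element. -/
theorem word_length_induction {P : List B → W → Prop}
    (ind : ∀ l v, (∀ l' v', l'.length < l.length → P l' v') →
      (∀ l' v', l'.length = l.length → cs.length v' < cs.length v → P l' v') → P l v)
    (l : List B) (v : W) : P l v := by
  induction hn : l.length using Nat.strong_induction_on generalizing l v with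
  | _ n ihn =>
    subst hn
    induction hm : cs.length v using Nat.strong_induction_on generalizing l v with
    | _ m ihm =>
      subst hm
      exact ind l v (fun l' v' h => ihn _ h _ _ rfl)
        (fun l' v' h hv => ihm _ hv l' v' (by rwa [h]) rfl)

theorem piDown_mem_parabolic (l : List B) (w : W) : piDown cs l w ∈ parabolic cs {i | i ∈ l} := by
  induction l, w using word_length_induction cs with
  | ind l w ih1 ih2 =>
    cases l with
    | nil => rw [piDown_nil]; exact one_mem _
    | cons s l =>
      by_cases h : cs.IsLeftDescent w s
      · rw [piDown_of_isLeftDescent cs h]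
        refine mul_mem (simple_mem_parabolic cs List.mem_cons_self) ?_
        rw [← letters_rotate]
        exact ih2 _ _ (by simp) h
      · rw [piDown_of_not_isLeftDescent cs h]
        exact parabolic_mono cs (letters_subset_cons s l) (ih1 _ _ (by simp))

include hA in
/-- The inversions of `piDown l w` are inversions of `w`. -/
theorem reflRep_inv_nonpos_of_piDown (l : List B) (w : W) {β : B →₀ ℝ}
    (hβ : IsRoot cs hA β) (h0 : 0 ≤ β) (h : reflRep cs hA (piDown cs l w)⁻¹ β ≤ 0) :
    reflRep cs hA w⁻¹ β ≤ 0 := by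
  induction l, w using word_length_induction cs generalizing β with
  | ind l w ih1 ih2 =>
    cases l with
    | nil =>
      rw [piDown_nil, inv_one, reflRep_one] at h
      exact absurd h0 (hβ.not_nonneg_iff.mpr h)
    | cons s l =>
      by_cases hs : cs.IsLeftDescent w s
      · rw [piDown_of_isLeftDescent cs hs, reflRep_inv_simple_mul] at h
        rcases (hβ.map (cs.simple s)).nonneg_or_nonpos with h1 | h1
        · have := ih2 _ _ (by simp) hs (hβ.map _) h1 h
          rwa [reflRep_inv_simple_mul, reflRep_simple_simple] at this
        · obtain ⟨hpos, he⟩ := hβ.eq_smul_simpleRoot cs hA h0 h1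
          rw [he, map_smul]
          exact smul_nonpos_of_nonneg_of_nonpos hpos.le ((isLeftDescent_iff_nonpos cs hA).mp hs)
      · rw [piDown_of_not_isLeftDescent cs hs] at h
        have hw := ih1 _ _ (by simp) hβ h0 h
        -- The coordinates outside `l` are unchanged by the inverse of the parabolic part; they are
        -- nonpositive after its action and nonnegative before, hence zero.
        have hmem : β ∈ letterSpan l := by
          rw [Finsupp.mem_supported']
          intro i hi
          refine le_antisymm ?_ (h0 i)
          have := hw i
          rwa [reflRep_apply_of_notMem cs hA (inv_mem (mul_inv_minCosetRep_mem cs _ w)) hi] at this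
        rw [← (hβ.map _).not_nonneg_iff] at hw ⊢
        rwa [← hβ.reflRep_parabolicPart_inv_nonneg_iff cs hA hmem]

variable {cs}

theorem SortableRec.isRoot_coneRoot {l : List B} {v : W} (h : SortableRec cs l v) {r : B}
    (hr : r ∈ l) : IsRoot cs hA (coneRoot cs hA l v r) := by
  induction h with
  | nil => simp at hr
  | step h _ ih =>
    rw [coneRoot_of_isLeftDescent cs hA h]
    exact (ih (mem_rotate_iff.mpr hr)).map _
  | @drop s l v h _ ih =>
    rcases eq_or_ne r s with rfl | hrs
    · rw [coneRoot_self_of_not_isLeftDescent cs hA h]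
      exact isRoot_simpleRoot r
    · rw [coneRoot_of_not_isLeftDescent cs hA h hrs]
      exact ih (List.mem_of_ne_of_mem hrs hr)

theorem SortableRec.coneRoot_mem {l : List B} {v : W} (h : SortableRec cs l v) {r : B}
    (hr : r ∈ l) : coneRoot cs hA l v r ∈ letterSpan l := by
  induction h with
  | nil => simp at hr
  | step h _ ih =>
    rw [coneRoot_of_isLeftDescent cs hA h]
    apply simple_mem_letterSpan
    rw [← letterSpan_rotate]
    exact ih (mem_rotate_iff.mpr hr)
  | @drop s l v h _ ih =>
    rcases eq_or_ne r s with rfl | hrs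
    · rw [coneRoot_self_of_not_isLeftDescent cs hA h]
      exact simpleRoot_mem_supported List.mem_cons_self
    · rw [coneRoot_of_not_isLeftDescent cs hA h hrs]
      exact letterSpan_le_cons s l (ih (List.mem_of_ne_of_mem hrs hr))

/-- Dually, the chamber of `v` itself lies in the Cambrian cone of `v`. -/
theorem SortableRec.inv_coneRoot_nonneg {l : List B} {v : W} (h : SortableRec cs l v) {r : B}
    (hr : r ∈ l) : 0 ≤ reflRep cs hA v⁻¹ (coneRoot cs hA l v r) := by
  induction h with
  | nil => simp at hr
  | step h _ ih =>
    rw [coneRoot_of_isLeftDescent cs hA h, ← reflRep_inv_simple_mul]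
    exact ih (mem_rotate_iff.mpr hr)
  | @drop s l v h _ ih =>
    rcases eq_or_ne r s with rfl | hrs
    · rw [coneRoot_self_of_not_isLeftDescent cs hA h]
      exact (not_isLeftDescent_iff_nonneg cs hA).mp h
    · rw [coneRoot_of_not_isLeftDescent cs hA h hrs]
      exact ih (List.mem_of_ne_of_mem hrs hr)

variable (cs)

/-! ### The Euler form -/

/-- The Euler form of the Coxeter element with reduced word `l`. -/
def eulerForm (A : Matrix B B ℝ) (δ : B → ℝ) : List B → (B →₀ ℝ) → (B →₀ ℝ) → ℝ
  | [], _, _ => 0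
  | s :: l, x, y => δ s * x s * (y s + (l.map fun j => A s j * y j).sum) + eulerForm A δ l x y

variable {δ : B → ℝ}

theorem sum_map_mul_congr {l : List B} (a : B → ℝ) {x y : B →₀ ℝ} (h : ∀ i ∈ l, x i = y i) :
    (l.map fun j => a j * x j).sum = (l.map fun j => a j * y j).sum := by
  rw [List.map_congr_left fun i hi => by rw [h i hi]]

theorem sum_map_mul_eq_zero {l : List B} (a : B → ℝ) {x : B →₀ ℝ} (h : ∀ i ∈ l, x i = 0) :
    (l.map fun j => a j * x j).sum = 0 := by
  rw [List.map_congr_left (g := fun _ => (0 : ℝ)) fun i hi => by rw [h i hi, mul_zero]]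
  simp

theorem eulerForm_congr {l : List B} {x x' y y' : B →₀ ℝ} (hx : ∀ i ∈ l, x i = x' i)
    (hy : ∀ i ∈ l, y i = y' i) : eulerForm A δ l x y = eulerForm A δ l x' y' := by
  induction l with
  | nil => rfl
  | cons s l ih =>
    simp only [List.forall_mem_cons] at hx hy
    rw [eulerForm, eulerForm, ih hx.2 hy.2, hx.1, hy.1, sum_map_mul_congr _ hy.2]

theorem eulerForm_eq_zero_of_left {l : List B} {x : B →₀ ℝ} (hx : ∀ i ∈ l, x i = 0)
    (y : B →₀ ℝ) : eulerForm A δ l x y = 0 := by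
  induction l with
  | nil => rfl
  | cons s l ih =>
    simp only [List.forall_mem_cons] at hx
    rw [eulerForm, ih hx.2, hx.1]; ring

theorem eulerForm_eq_zero_of_right {l : List B} (x : B →₀ ℝ) {y : B →₀ ℝ}
    (hy : ∀ i ∈ l, y i = 0) : eulerForm A δ l x y = 0 := by
  induction l with
  | nil => rfl
  | cons s l ih =>
    simp only [List.forall_mem_cons] at hy
    rw [eulerForm, ih hy.2, hy.1, sum_map_mul_eq_zero _ hy.2]; ring

theorem eulerForm_append (hδ : ∀ i j, δ i * A i j = δ j * A j i) (l : List B) (s : B)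
    (x y : B →₀ ℝ) :
    eulerForm A δ (l ++ [s]) x y =
      eulerForm A δ l x y + δ s * (x s + (l.map fun j => A s j * x j).sum) * y s := by
  induction l with
  | nil => simp [eulerForm]
  | cons a l ih =>
    simp only [List.cons_append, eulerForm, ih, List.map_append, List.sum_append, List.map_cons,
      List.map_nil, List.sum_cons, List.sum_nil]
    linear_combination x a * y s * hδ a s

theorem corootFunctional_of_mem {s : B} {l : List B} (hl : (s :: l).Nodup)
    (hA : IsGeneralizedCartan M A) {x : B →₀ ℝ} (hx : x ∈ letterSpan (s :: l)) :
    corootFunctional A s x = 2 * x s + (l.map fun j => A s j * x j).sum := by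
  classical
  rw [corootFunctional, Finsupp.linearCombination_apply,
    Finsupp.sum_of_support_subset x (s := (s :: l).toFinset) ?_ _ (by simp),
    List.sum_toFinset _ hl, List.map_cons, List.sum_cons, hA.diag, smul_eq_mul, mul_comm (x s)]
  · simp only [smul_eq_mul, mul_comm]
  · intro i hi
    simpa using hx hi

/-- The reflection changes only the coordinate at `s`, replacing x_s by -(x_s + Σ a_sj x_j). The
contribution of `s` as first letter thereby becomes its contribution as last letter;
symmetrizability enters through `eulerForm_append`. -/
theorem eulerForm_rotate (hδ : ∀ i j, δ i * A i j = δ j * A j i) {s : B} {l : List B}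
    (hl : (s :: l).Nodup) {x y : B →₀ ℝ} (hx : x ∈ letterSpan (s :: l))
    (hy : y ∈ letterSpan (s :: l)) :
    eulerForm A δ (l ++ [s]) (reflRep cs hA (cs.simple s) x) (reflRep cs hA (cs.simple s) y) =
      eulerForm A δ (s :: l) x y := by
  have hne : ∀ i ∈ l, s ≠ i := fun i hi h => (List.nodup_cons.mp hl).1 (h ▸ hi)
  have hc : ∀ z : B →₀ ℝ, ∀ i ∈ l, reflRep cs hA (cs.simple s) z i = z i := fun z i hi =>
    reflRep_simple_apply_of_ne cs hA (hne i hi) z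
  rw [eulerForm_append hδ, eulerForm_congr (hc x) (hc y), sum_map_mul_congr _ (hc x),
    reflRep_simple_apply_self, reflRep_simple_apply_self, corootFunctional_of_mem hl hA hx,
    corootFunctional_of_mem hl hA hy, eulerForm]
  ring

/-- For `s` final, pairing with α_s on the right is, up to sign and scale, the `s`-coordinate after
reflection, so its sign can be read off. -/
theorem eulerForm_simpleRoot_right (hδ : ∀ i j, δ i * A i j = δ j * A j i) {s : B} {l : List B}
    (hl : (s :: l).Nodup) {x : B →₀ ℝ} (hx : x ∈ letterSpan (s :: l)) :
    eulerForm A δ (l ++ [s]) x (simpleRoot s) =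
      -(δ s * reflRep cs hA (cs.simple s) x s) := by
  have hne : ∀ i ∈ l, s ≠ i := fun i hi h => (List.nodup_cons.mp hl).1 (h ▸ hi)
  rw [eulerForm_append hδ, eulerForm_eq_zero_of_right x fun i hi =>
    simpleRoot_apply_of_ne (hne i hi), reflRep_simple_apply_self, corootFunctional_of_mem hl hA hx,
    simpleRoot_apply_self]
  ring

theorem eulerForm_smul_simpleRoot_left (hδ : ∀ i j, δ i * A i j = δ j * A j i) {s : B}
    {l : List B} (hl : (s :: l).Nodup) (κ : ℝ) (y : B →₀ ℝ) :
    eulerForm A δ (l ++ [s]) (κ • simpleRoot s) y = δ s * κ * y s := by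
  have hz : ∀ i ∈ l, (κ • simpleRoot s) i = 0 := fun i hi => by
    rw [Finsupp.smul_apply, simpleRoot_apply_of_ne (ne_of_mem_of_not_mem hi (List.nodup_cons.mp hl).1).symm,
      smul_zero]
  rw [eulerForm_append hδ, eulerForm_eq_zero_of_left hz, sum_map_mul_eq_zero _ hz,
    Finsupp.smul_apply, simpleRoot_apply_self, smul_eq_mul]
  ring

theorem eulerForm_simpleRoot_left {s : B} {l : List B} (hl : (s :: l).Nodup)
    (hA : IsGeneralizedCartan M A) {y : B →₀ ℝ} (hy : y ∈ letterSpan (s :: l)) :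
    eulerForm A δ (s :: l) (simpleRoot s) y = δ s * (corootFunctional A s y - y s) := by
  have hz : ∀ i ∈ l, simpleRoot s i = 0 := fun i hi =>
    simpleRoot_apply_of_ne fun h => (List.nodup_cons.mp hl).1 (h ▸ hi)
  rw [eulerForm, eulerForm_eq_zero_of_left hz, corootFunctional_of_mem hl hA hy,
    simpleRoot_apply_self]
  ring

theorem eulerForm_cons_of_mem {s : B} {l : List B} (hs : s ∉ l) {x : B →₀ ℝ}
    (hx : x ∈ letterSpan l) (y : B →₀ ℝ) :
    eulerForm A δ (s :: l) x y = eulerForm A δ l x y := by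
  rw [eulerForm, apply_eq_zero_of_mem_letterSpan hx hs]; ring

/-! ### The basis dual to the cone roots -/

variable {cs}

/-- The coefficients of vectors with respect to the cone roots of a sortable element are either
coefficients with respect to the simple roots, or negative multiples of pairings with an inversion
under the Euler form. -/
theorem SortableRec.exists_coefficients (hpos : ∀ i, 0 < δ i)
    (hδ : ∀ i j, δ i * A i j = δ j * A j i) {l : List B} {v : W}
    (h : SortableRec cs l v) (hl : l.Nodup) :
    ∃ g : B → (B →₀ ℝ) → ℝ,
      (∀ x ∈ letterSpan l, x = (l.map fun r => g r x • coneRoot cs hA l v r).sum) ∧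
      ∀ r ∈ l, (∀ x ∈ letterSpan l, g r x = x r) ∨
        ∃ κ > 0, ∃ β, IsRoot cs hA β ∧ 0 ≤ β ∧ β ∈ letterSpan l ∧ reflRep cs hA v⁻¹ β ≤ 0 ∧
          ∀ x ∈ letterSpan l, g r x = -(κ * eulerForm A δ l β x) := by
  classical
  induction h with
  | nil =>
    refine ⟨fun _ _ => 0, fun x hx => ?_, by simp⟩
    ext i
    simpa using apply_eq_zero_of_mem_letterSpan hx (List.not_mem_nil (a := i))
  | @step s l v h hv ih =>
    obtain ⟨g, hg, hg'⟩ := ih (nodup_rotate hl)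
    have hmem : ∀ x ∈ letterSpan (s :: l), reflRep cs hA (cs.simple s) x ∈
        letterSpan (l ++ [s]) := fun x hx => by
      rw [letterSpan_rotate]; exact simple_mem_letterSpan cs hA hx
    refine ⟨fun r x => g r (reflRep cs hA (cs.simple s) x), fun x hx => ?_, fun r hr => ?_⟩
    · have := congrArg (reflRep cs hA (cs.simple s)) (hg _ (hmem x hx))
      rw [reflRep_simple_simple, sum_map_rotate, map_list_sum, List.map_map] at this
      refine this.trans (congrArg List.sum (List.map_congr_left fun r _ => ?_))
      rw [Function.comp_apply, map_smul, coneRoot_of_isLeftDescent cs hA h]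
    · beta_reduce
      rcases hg' r (mem_rotate_iff.mpr hr) with h1 | ⟨κ, hκ, β, hβ, h0, hβl, hβv, hE⟩
      · rcases eq_or_ne s r with rfl | hrs
        · right
          -- The coordinate functional at `s`, pulled back along the reflection, is -δ_s⁻¹ E(α_s,
          -- ·), and α_s is an inversion since `v ≥ s`.
          refine ⟨(δ s)⁻¹, inv_pos.mpr (hpos s), simpleRoot s, isRoot_simpleRoot s,
            simpleRoot_nonneg s, simpleRoot_mem_supported List.mem_cons_self,
            (isLeftDescent_iff_nonpos cs hA).mp h, fun x hx => ?_⟩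
          rw [h1 _ (hmem x hx), reflRep_simple_apply_self, eulerForm_simpleRoot_left hl hA hx,
            ← mul_assoc, inv_mul_cancel₀ (hpos s).ne']
          ring
        · left
          intro x hx
          rw [h1 _ (hmem x hx), reflRep_simple_apply_of_ne cs hA hrs]
      · right
        rw [letterSpan_rotate] at hβl
        -- If sβ were negative, β would be a positive multiple of α_s and an inversion of `sv`,
        -- although `sv ≱ s`.
        have hsβ : 0 ≤ reflRep cs hA (cs.simple s) β := by
          rcases (hβ.map (cs.simple s)).nonneg_or_nonpos with h2 | h2
          · exact h2
          · exfalso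
            rw [reflRep_inv_simple_mul] at hβv
            obtain ⟨hκ', he⟩ := hβ.eq_smul_simpleRoot cs hA h0 h2
            rw [he, map_smul, reflRep_simple_self, smul_neg, map_neg, map_smul] at hβv
            have h3 := ((isRoot_simpleRoot (cs := cs) (hA := hA) s).map v⁻¹).not_nonneg_iff.mpr
              ((isLeftDescent_iff_nonpos cs hA).mp h)
            have := smul_nonneg (inv_pos.mpr hκ').le (neg_nonpos.mp hβv)
            rw [inv_smul_smul₀ hκ'.ne'] at this
            exact h3 this
        refine ⟨κ, hκ, reflRep cs hA (cs.simple s) β, hβ.map _, hsβ,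
          simple_mem_letterSpan cs hA hβl, ?_, fun x hx => ?_⟩
        · rwa [reflRep_inv_simple_mul] at hβv
        · rw [hE _ (hmem x hx), ← eulerForm_rotate cs hA hδ hl (simple_mem_letterSpan cs hA hβl) hx,
            reflRep_simple_simple]
  | @drop s l v h hv ih =>
    obtain ⟨hsl, hl'⟩ := List.nodup_cons.mp hl
    obtain ⟨g, hg, hg'⟩ := ih hl'
    have hmem : ∀ x ∈ letterSpan (s :: l), x - x s • simpleRoot s ∈ letterSpan l := by
      intro x hx
      rw [Finsupp.mem_supported']
      intro i hi
      rcases eq_or_ne s i with rfl | hsi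
      · simp [simpleRoot_apply_self]
      · have : i ∉ s :: l := by simpa [hsi.symm] using hi
        simp [simpleRoot_apply_of_ne hsi, apply_eq_zero_of_mem_letterSpan hx this]
    have happ : ∀ x : B →₀ ℝ, ∀ i ∈ l, (x - x s • simpleRoot s) i = x i := fun x i hi => by
      have : s ≠ i := fun h => hsl (h ▸ hi)
      simp [simpleRoot_apply_of_ne this]
    have hne : ∀ i ∈ l, i ≠ s := fun i hi h => hsl (h ▸ hi)
    refine ⟨fun r x => if r = s then x s else g r (x - x s • simpleRoot s), fun x hx => ?_,
      fun r hr => ?_⟩ <;> beta_reduce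
    · rw [List.map_cons, List.sum_cons, if_pos rfl, coneRoot_self_of_not_isLeftDescent cs hA h]
      have := hg _ (hmem x hx)
      rw [List.map_congr_left (g := fun r => g r (x - x s • simpleRoot s) • coneRoot cs hA l v r)
        fun r hr => by rw [if_neg (hne r hr), coneRoot_of_not_isLeftDescent cs hA h (hne r hr)],
        ← this]
      abel
    · rcases List.mem_cons.mp hr with rfl | hr
      · left; intro x _; rw [if_pos rfl]
      · simp only [if_neg (hne r hr)]
        rcases hg' r hr with h1 | ⟨κ, hκ, β, hβ, h0, hβl, hβv, hE⟩
        · left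
          intro x hx
          rw [h1 _ (hmem x hx), happ x r hr]
        · right
          refine ⟨κ, hκ, β, hβ, h0, letterSpan_le_cons s l hβl, hβv, fun x hx => ?_⟩
          rw [hE _ (hmem x hx), eulerForm_cons_of_mem hsl hβl,
            eulerForm_congr (fun i _ => rfl) (happ x)]

/-- If `s` is final and `v ≱ s`, then the simple root of `s` is a nonnegative combination of the
cone roots of `v`. -/
theorem SortableRec.exists_simpleRoot_eq_sum (hpos : ∀ i, 0 < δ i)
    (hδ : ∀ i j, δ i * A i j = δ j * A j i) {l : List B} {s : B} {v : W}
    (h : SortableRec cs (l ++ [s]) v) (hl : (s :: l).Nodup) (hs : ¬ cs.IsLeftDescent v s) :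
    ∃ g : B → ℝ, (∀ r ∈ l ++ [s], 0 ≤ g r) ∧
      simpleRoot s = ((l ++ [s]).map fun r => g r • coneRoot cs hA (l ++ [s]) v r).sum := by
  obtain ⟨g, hg, hg'⟩ := h.exists_coefficients hA hpos hδ (nodup_rotate hl)
  have hmem : simpleRoot s ∈ letterSpan (l ++ [s]) := simpleRoot_mem_supported (by simp)
  refine ⟨fun r => g r (simpleRoot s), fun r hr => ?_, hg _ hmem⟩
  beta_reduce
  rcases hg' r hr with h1 | ⟨κ, hκ, β, hβ, h0, hβl, hβv, hE⟩
  · rw [h1 _ hmem]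
    exact simpleRoot_nonneg s r
  · rw [letterSpan_rotate] at hβl
    rw [hE _ hmem, eulerForm_simpleRoot_right cs hA hδ hl hβl, mul_neg, neg_neg]
    refine mul_nonneg hκ.le (mul_nonneg (hpos s).le ?_)
    -- The coefficient is δ_s κ times the `s`-coordinate of sβ. If sβ were negative, β would be a
    -- multiple of α_s and thus `s` a descent of `v`.
    rcases (hβ.map (cs.simple s)).nonneg_or_nonpos with h2 | h2
    · exact h2 s
    · exfalso
      obtain ⟨hκ', he⟩ := hβ.eq_smul_simpleRoot cs hA h0 h2
      rw [he, map_smul] at hβv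
      have h3 := ((isRoot_simpleRoot (cs := cs) (hA := hA) s).map v⁻¹).not_nonpos_iff.mpr
        ((not_isLeftDescent_iff_nonneg cs hA).mp hs)
      refine h3 ?_
      have := smul_nonpos_of_nonneg_of_nonpos (inv_pos.mpr hκ').le hβv
      rwa [inv_smul_smul₀ hκ'.ne'] at this

theorem SortableRec.nonneg_of_forall_coneRoot_nonneg (hpos : ∀ i, 0 < δ i)
    (hδ : ∀ i j, δ i * A i j = δ j * A j i) {l : List B} {s : B} {v : W}
    (h : SortableRec cs (l ++ [s]) v) (hl : (s :: l).Nodup) (hs : ¬ cs.IsLeftDescent v s)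
    {N : Type*} [AddCommGroup N] [PartialOrder N] [IsOrderedAddMonoid N] [Module ℝ N]
    [PosSMulMono ℝ N] (f : (B →₀ ℝ) →ₗ[ℝ] N)
    (hf : ∀ r ∈ s :: l, 0 ≤ f (coneRoot cs hA (l ++ [s]) v r)) :
    0 ≤ f (simpleRoot s) := by
  obtain ⟨g, hg, he⟩ := h.exists_simpleRoot_eq_sum hA hpos hδ hl hs
  rw [he, map_list_sum, List.map_map]
  apply List.sum_nonneg
  intro x hx
  obtain ⟨r, hr, rfl⟩ := List.mem_map.mp hx
  rw [Function.comp_apply, map_smul]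
  exact smul_nonneg (hg r hr) (hf r (mem_rotate_iff.mp hr))

/-! ### The fibres of the projection -/

/-- When `v` and `w` agree about lying above the initial letter, both recursions take the same
branch and induction applies, roots in the parabolic span having the same sign under `w⁻¹` as under
the inverse of the parabolic part of `w`. When they disagree, both sides are false. -/
theorem SortableRec.piDown_eq_iff (hpos : ∀ i, 0 < δ i)
    (hδ : ∀ i j, δ i * A i j = δ j * A j i) {l : List B} {v : W}
    (h : SortableRec cs l v) (hl : l.Nodup) (w : W) :
    piDown cs l w = v ↔ ∀ r ∈ l, 0 ≤ reflRep cs hA w⁻¹ (coneRoot cs hA l v r) := by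
  induction h generalizing w with
  | nil => simp [piDown_nil]
  | @step s l v h hv ih =>
    by_cases hw : cs.IsLeftDescent w s
    · rw [piDown_of_isLeftDescent cs hw, ← eq_inv_mul_iff_mul_eq, cs.inv_simple,
        ih (nodup_rotate hl)]
      simp only [mem_rotate_iff, reflRep_inv_simple_mul, coneRoot_of_isLeftDescent cs hA h]
    · constructor
      · rintro rfl
        rw [piDown_of_not_isLeftDescent cs hw] at h
        exact absurd h (not_isLeftDescent_of_mem_parabolic cs (piDown_mem_parabolic cs l _)
          (List.nodup_cons.mp hl).1 hA)
      · intro hC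
        exfalso
        -- Applying w⁻¹s to α_s as a nonnegative combination of the cone roots of `sv` gives
        -- w⁻¹(-α_s) ≥ 0, contradicting `w ≱ s`.
        have h1 := hv.nonneg_of_forall_coneRoot_nonneg hA hpos hδ hl
          (cs.isLeftDescent_iff_not_isLeftDescent_mul.mp h)
          ((reflRep cs hA w⁻¹).comp (reflRep cs hA (cs.simple s)))
          (fun r hr => by
            rw [LinearMap.comp_apply, ← coneRoot_of_isLeftDescent cs hA h]; exact hC r hr)
        rw [LinearMap.comp_apply, reflRep_simple_self, map_neg, neg_nonneg,
          ← isLeftDescent_iff_nonpos] at h1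
        exact hw h1
  | @drop s l v h hv ih =>
    have hne : ∀ i ∈ l, i ≠ s := fun i hi h => (List.nodup_cons.mp hl).1 (h ▸ hi)
    by_cases hw : cs.IsLeftDescent w s
    · constructor
      · intro he
        exfalso
        rw [piDown_of_isLeftDescent cs hw] at he
        -- Since `v ≱ s`, the projection of `sw` would lie above `s`, making α_s an inversion of
        -- `sw`, against `w ≥ s`.
        have h1 : cs.IsLeftDescent (piDown cs (l ++ [s]) (cs.simple s * w)) s := by
          rw [cs.isLeftDescent_iff_not_isLeftDescent_mul, he]; exact h
        have h2 := reflRep_inv_nonpos_of_piDown cs hA (l ++ [s]) (cs.simple s * w)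
          (isRoot_simpleRoot s) (simpleRoot_nonneg s) ((isLeftDescent_iff_nonpos cs hA).mp h1)
        rw [← isLeftDescent_iff_nonpos] at h2
        exact (cs.isLeftDescent_iff_not_isLeftDescent_mul.mp hw) h2
      · intro hC
        have := hC s List.mem_cons_self
        rw [coneRoot_self_of_not_isLeftDescent cs hA h, ← not_isLeftDescent_iff_nonneg] at this
        exact absurd hw this
    · rw [piDown_of_not_isLeftDescent cs hw, ih (List.nodup_cons.mp hl).2, List.forall_mem_cons,
        coneRoot_self_of_not_isLeftDescent cs hA h, ← not_isLeftDescent_iff_nonneg,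
        and_iff_right hw]
      refine forall₂_congr fun r hr => ?_
      rw [coneRoot_of_not_isLeftDescent cs hA h (hne r hr)]
      exact (hv.isRoot_coneRoot hA hr).reflRep_parabolicPart_inv_nonneg_iff cs hA
        (hv.coneRoot_mem hA hr)

/-! ### Negative cone roots and covers -/

variable (cs) in
-- Read a reduced word of `u` from the left. If every letter commutes with `q`, then α_q is fixed.
-- Otherwise the first non-commuting letter gives a simple root pairing negatively with the coroot
-- of `q`; carrying it back through the earlier commuting letters does not change this pairing.
theorem reflRep_inv_simpleRoot_eq_or_exists {J : Set B} {q : B} (hq : q ∉ J) {u : W}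
    (hu : u ∈ parabolic cs J) :
    reflRep cs hA u⁻¹ (simpleRoot q) = simpleRoot q ∨
      ∃ β, IsRoot cs hA β ∧ 0 ≤ β ∧ β ∈ Finsupp.supported ℝ ℝ J ∧ reflRep cs hA u⁻¹ β ≤ 0 ∧
        corootFunctional A q β < 0 := by
  induction hn : cs.length u using Nat.strong_induction_on generalizing u with
  | _ n ih =>
    subst hn
    rcases eq_or_ne u 1 with rfl | hu1
    · left; rw [inv_one, reflRep_one]
    obtain ⟨a, ha⟩ := cs.exists_leftDescent_of_ne_one hu1
    have haJ : a ∈ J := by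
      by_contra h
      exact not_isLeftDescent_of_mem_parabolic cs hu h hA ha
    have hqa : q ≠ a := fun h => hq (h ▸ haJ)
    rcases (hA.nonpos q a hqa).lt_or_eq with hlt | heq
    · right
      exact ⟨simpleRoot a, isRoot_simpleRoot a, simpleRoot_nonneg a, simpleRoot_mem_supported haJ,
        (isLeftDescent_iff_nonpos cs hA).mp ha, by rwa [corootFunctional_simpleRoot]⟩
    · rcases ih _ ha (mul_mem (simple_mem_parabolic cs haJ) hu) rfl with
        h | ⟨β, hβ, h0, hβJ, hβu, hβq⟩
      · left
        rwa [reflRep_inv_simple_mul, reflRep_simple_simpleRoot, (hA.zero_iff q a).mp heq, zero_smul,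
          sub_zero] at h
      · right
        have hs : 0 ≤ reflRep cs hA (cs.simple a) β := by
          rcases (hβ.map (cs.simple a)).nonneg_or_nonpos with h2 | h2
          · exact h2
          · exfalso
            obtain ⟨_, he⟩ := hβ.eq_smul_simpleRoot cs hA h0 h2
            rw [he, map_smul, corootFunctional_simpleRoot, heq, smul_zero] at hβq
            exact lt_irrefl _ hβq
        refine ⟨_, hβ.map _, hs, reflRep_mem_supported cs hA (simple_mem_parabolic cs haJ) hβJ,
          by rwa [reflRep_inv_simple_mul] at hβu, ?_⟩
        rwa [reflRep_simple, map_sub, map_smul, corootFunctional_simpleRoot, heq, smul_zero,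
          sub_zero]

/-- The alternative of `reflRep_inv_simpleRoot_eq_or_exists` arises where the letter `r` is dropped,
and is transported back along the recursion by invariance of the Euler form. It certifies that a
cone root is v α_r once the second case is excluded by a sign. -/
theorem SortableRec.inv_coneRoot_eq_or_exists (hpos : ∀ i, 0 < δ i)
    (hδ : ∀ i j, δ i * A i j = δ j * A j i) {l : List B} {v : W}
    (h : SortableRec cs l v) (hl : l.Nodup) {r : B} (hr : r ∈ l) :
    reflRep cs hA v⁻¹ (coneRoot cs hA l v r) = simpleRoot r ∨
      ∃ β, IsRoot cs hA β ∧ 0 ≤ β ∧ β ∈ letterSpan l ∧ reflRep cs hA v⁻¹ β ≤ 0 ∧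
        eulerForm A δ l (coneRoot cs hA l v r) β < 0 := by
  induction h with
  | nil => simp at hr
  | @step s l v h hv ih =>
    rw [coneRoot_of_isLeftDescent cs hA h, ← reflRep_inv_simple_mul]
    have hr' := mem_rotate_iff.mpr hr
    rcases ih (nodup_rotate hl) hr' with h1 | ⟨β, hβ, h0, hβl, hβv, hE⟩
    · exact Or.inl h1
    · right
      have hC := hv.coneRoot_mem hA hr'
      rw [letterSpan_rotate] at hβl hC
      have hsβ : 0 ≤ reflRep cs hA (cs.simple s) β := by
        rcases (hβ.map (cs.simple s)).nonneg_or_nonpos with h2 | h2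
        · exact h2
        · exfalso
          obtain ⟨hκ', he⟩ := hβ.eq_smul_simpleRoot cs hA h0 h2
          have h3 := (not_isLeftDescent_iff_nonneg cs hA).mp
            (cs.isLeftDescent_iff_not_isLeftDescent_mul.mp h)
          refine (hβ.map _).not_nonneg_iff.mpr hβv ?_
          rw [he, map_smul]
          exact smul_nonneg hκ'.le h3
      refine ⟨_, hβ.map _, hsβ, simple_mem_letterSpan cs hA hβl,
        by rwa [reflRep_inv_simple_mul] at hβv, ?_⟩
      rwa [← eulerForm_rotate cs hA hδ hl (simple_mem_letterSpan cs hA hC)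
        (simple_mem_letterSpan cs hA hβl), reflRep_simple_simple, reflRep_simple_simple]
  | @drop s l v h hv ih =>
    obtain ⟨hsl, hl'⟩ := List.nodup_cons.mp hl
    rcases eq_or_ne r s with rfl | hrs
    · rw [coneRoot_self_of_not_isLeftDescent cs hA h]
      rcases reflRep_inv_simpleRoot_eq_or_exists cs hA (J := {i | i ∈ l}) hsl hv.mem_parabolic with
        h1 | ⟨β, hβ, h0, hβl, hβv, hE⟩
      · exact Or.inl h1
      · right
        have hβl' := letterSpan_le_cons r l hβl
        refine ⟨β, hβ, h0, hβl', hβv, ?_⟩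
        rw [eulerForm_simpleRoot_left hl hA hβl', apply_eq_zero_of_mem_letterSpan hβl hsl, sub_zero]
        exact mul_neg_of_pos_of_neg (hpos r) hE
    · rw [coneRoot_of_not_isLeftDescent cs hA h hrs]
      have hr' := List.mem_of_ne_of_mem hrs hr
      rcases ih hl' hr' with h1 | ⟨β, hβ, h0, hβl, hβv, hE⟩
      · exact Or.inl h1
      · right
        refine ⟨β, hβ, h0, letterSpan_le_cons s l hβl, hβv, ?_⟩
        rwa [eulerForm_cons_of_mem hsl (hv.coneRoot_mem hA hr')]

/-- The negative cone roots of `v` are images under `v` of simple roots. -/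
theorem SortableRec.inv_coneRoot_eq_of_nonpos (hpos : ∀ i, 0 < δ i)
    (hδ : ∀ i j, δ i * A i j = δ j * A j i) {l : List B} {v : W}
    (h : SortableRec cs l v) (hl : l.Nodup) {r : B} (hr : r ∈ l)
    (hC : coneRoot cs hA l v r ≤ 0) :
    reflRep cs hA v⁻¹ (coneRoot cs hA l v r) = simpleRoot r := by
  induction h with
  | nil => simp at hr
  | @step s l v h hv ih =>
    rw [coneRoot_of_isLeftDescent cs hA h] at hC ⊢
    rw [← reflRep_inv_simple_mul]
    have hr' := mem_rotate_iff.mpr hr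
    have hroot := hv.isRoot_coneRoot hA hr'
    rcases hroot.nonneg_or_nonpos with h1 | h1
    -- At the step where the cone root turns negative it was κ α_s with `s` final. Then E(κ α_s, β)
    -- = δ_s κ β_s ≥ 0 for every positive β, which excludes the second alternative.
    · obtain ⟨hκ, he⟩ := hroot.eq_smul_simpleRoot cs hA h1 hC
      refine (hv.inv_coneRoot_eq_or_exists hA hpos hδ (nodup_rotate hl) hr').resolve_right ?_
      rintro ⟨β, -, h0, -, -, hE⟩
      rw [he, eulerForm_smul_simpleRoot_left hδ hl] at hE
      exact absurd hE (not_lt.mpr (mul_nonneg (mul_nonneg (hpos s).le hκ.le) (h0 s)))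
    · exact ih (nodup_rotate hl) hr' h1
  | @drop s l v h hv ih =>
    rcases eq_or_ne r s with rfl | hrs
    · rw [coneRoot_self_of_not_isLeftDescent cs hA h] at hC
      exact absurd (simpleRoot_nonneg r) ((isRoot_simpleRoot (cs := cs) (hA := hA) r).not_nonneg_iff.mpr hC)
    · rw [coneRoot_of_not_isLeftDescent cs hA h hrs] at hC ⊢
      exact ih (List.nodup_cons.mp hl).2 (List.mem_of_ne_of_mem hrs hr) hC

variable (cs) in
/-- If a simple root is a nonnegative combination of roots that are all nonnegative, then one of
them is a multiple of it. -/
theorem exists_eq_smul_of_sum_eq {l : List B} {f : B → (B →₀ ℝ)} {g : B → ℝ} {i : B} {κ : ℝ}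
    (hκ : 0 < κ) (hf : ∀ r ∈ l, IsRoot cs hA (f r)) (hf0 : ∀ r ∈ l, 0 ≤ f r)
    (hg : ∀ r ∈ l, 0 ≤ g r) (h : κ • simpleRoot i = (l.map fun r => g r • f r).sum) :
    ∃ r ∈ l, ∃ κ' > (0 : ℝ), f r = κ' • simpleRoot i := by
  have happ : ∀ j, (κ • simpleRoot i) j = (l.map fun r => g r * f r j).sum := by
    intro j
    rw [h, ← Finsupp.applyAddHom_apply, map_list_sum, List.map_map]
    rfl
  obtain ⟨r, hr, hgr⟩ : ∃ r ∈ l, g r ≠ 0 := by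
    by_contra! hall
    have := happ i
    rw [List.map_congr_left (g := fun _ => (0 : ℝ)) fun r hr => by rw [hall r hr, zero_mul]] at this
    simp [simpleRoot_apply_self, hκ.ne'] at this
  have hgr' : 0 < g r := lt_of_le_of_ne (hg r hr) hgr.symm
  have hz : ∀ j, i ≠ j → f r j = 0 := by
    intro j hj
    have h1 := happ j
    rw [Finsupp.smul_apply, simpleRoot_apply_of_ne hj, smul_zero] at h1
    have h2 : g r * f r j ≤ 0 := by
      rw [h1]
      refine List.single_le_sum ?_ _ (List.mem_map.mpr ⟨r, hr, rfl⟩)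
      intro x hx
      obtain ⟨r', hr', rfl⟩ := List.mem_map.mp hx
      exact mul_nonneg (hg r' hr') (hf0 r' hr' j)
    refine le_antisymm ?_ (hf0 r hr j)
    exact nonpos_of_mul_nonpos_right h2 hgr'
  have he := eq_smul_simpleRoot hz
  refine ⟨r, hr, f r i, lt_of_le_of_ne (hf0 r hr i) fun h0 => (hf r hr).ne_zero ?_, he⟩
  rw [he, ← h0, zero_smul]

/-- The images under `v` of the simple roots at its right descents are, up to scaling, cone
roots of `v`. -/
theorem SortableRec.exists_coneRoot_eq_smul (hpos : ∀ i, 0 < δ i)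
    (hδ : ∀ i j, δ i * A i j = δ j * A j i) {l : List B} {v : W}
    (h : SortableRec cs l v) (hl : l.Nodup) {i : B} (hi : reflRep cs hA v (simpleRoot i) ≤ 0) :
    ∃ r ∈ l, ∃ κ > (0 : ℝ), coneRoot cs hA l v r = κ • reflRep cs hA v (simpleRoot i) := by
  induction h with
  | nil =>
    rw [reflRep_one] at hi
    exact absurd (simpleRoot_nonneg i) ((isRoot_simpleRoot (cs := cs) (hA := hA) i).not_nonneg_iff.mpr hi)
  | @step s l v h hv ih =>
    have hroot := (isRoot_simpleRoot (cs := cs) (hA := hA) i).map (cs.simple s * v)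
    have hvs : reflRep cs hA v (simpleRoot i) =
        reflRep cs hA (cs.simple s) (reflRep cs hA (cs.simple s * v) (simpleRoot i)) := by
      rw [← reflRep_mul, cs.simple_mul_simple_cancel_left]
    suffices ∃ r ∈ l ++ [s], ∃ κ > (0 : ℝ), coneRoot cs hA (l ++ [s]) (cs.simple s * v) r =
        κ • reflRep cs hA (cs.simple s * v) (simpleRoot i) by
      obtain ⟨r, hr, κ, hκ, he⟩ := this
      refine ⟨r, mem_rotate_iff.mp hr, κ, hκ, ?_⟩
      rw [coneRoot_of_isLeftDescent cs hA h, he, map_smul, hvs]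
    rcases hroot.nonneg_or_nonpos with h1 | h1
    · rw [hvs] at hi
      obtain ⟨hκ, he⟩ := hroot.eq_smul_simpleRoot cs hA h1 hi
      set κ := reflRep cs hA (cs.simple s * v) (simpleRoot i) s with hκdef
      -- Here sv α_i = κ α_s. Applying (sv)⁻¹ to the expansion of α_s writes a positive multiple of
      -- α_i as a nonnegative combination of positive roots, so one of them is proportional to α_i.
      obtain ⟨g, hg, hsum⟩ := hv.exists_simpleRoot_eq_sum hA hpos hδ hl
        (cs.isLeftDescent_iff_not_isLeftDescent_mul.mp h)
      have hsum' : κ⁻¹ • simpleRoot i = ((l ++ [s]).map fun r => g r •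
          reflRep cs hA (cs.simple s * v)⁻¹
            (coneRoot cs hA (l ++ [s]) (cs.simple s * v) r)).sum := by
        have h2 := congrArg (reflRep cs hA (cs.simple s * v)⁻¹) hsum
        rw [map_list_sum, List.map_map] at h2
        have h3 : simpleRoot i = κ • reflRep cs hA (cs.simple s * v)⁻¹ (simpleRoot s) := by
          rw [← map_smul, ← he, reflRep_inv_reflRep]
        rw [h3, inv_smul_smul₀ hκ.ne', h2]
        refine congrArg List.sum (List.map_congr_left fun r _ => ?_)
        rw [Function.comp_apply, map_smul]
      obtain ⟨r, hr, κ', hκ', hr'⟩ := exists_eq_smul_of_sum_eq cs hA (inv_pos.mpr hκ)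
        (fun r hr => (hv.isRoot_coneRoot hA hr).map _) (fun r hr => hv.inv_coneRoot_nonneg hA hr)
        hg hsum'
      refine ⟨r, hr, κ', hκ', ?_⟩
      rw [← map_smul, ← hr', reflRep_reflRep_inv]
    · exact ih (nodup_rotate hl) h1
  | @drop s l v h hv ih =>
    obtain ⟨r, hr, κ, hκ, he⟩ := ih (List.nodup_cons.mp hl).2 hi
    have hrs : r ≠ s := fun h => (List.nodup_cons.mp hl).1 (h ▸ hr)
    exact ⟨r, List.mem_cons_of_mem s hr, κ, hκ, by
      rw [coneRoot_of_not_isLeftDescent cs hA h hrs, he]⟩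

end SortableRecursion


/-! ### Independence of the reduced word chosen for the Coxeter element. -/

section Commutation

variable {B W : Type*} [Group W] {M : CoxeterMatrix B} (cs : CoxeterSystem M W)
  {A : Matrix B B ℝ} (hA : IsGeneralizedCartan M A)

/-! ### The standard Cartan matrix -/

/-- The symmetric generalized Cartan matrix of a Coxeter matrix. -/
noncomputable def standardCartan (M : CoxeterMatrix B) : Matrix B B ℝ :=
  fun i j => -2 * Real.cos (Real.pi / M i j)

theorem standardCartan_comm (M : CoxeterMatrix B) (i j : B) :
    standardCartan M i j = standardCartan M j i := by
  rw [standardCartan, standardCartan, show M i j = M j i from M.symmetric i j]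

/-- This supplies a symmetrizable matrix for statements that mention none, such as part 1. For m =
∞, coded as 0, the convention π/0 = 0 yields the entry -2. -/
theorem isGeneralizedCartan_standardCartan (M : CoxeterMatrix B) :
    IsGeneralizedCartan M (standardCartan M) where
  diag i := by simp [standardCartan]
  nonpos i j hij := by
    have h1 : M i j ≠ 1 := M.off_diagonal i j hij
    have : 0 ≤ Real.cos (Real.pi / M i j) := by
      rcases eq_or_ne (M i j) 0 with h0 | h0
      · simp [h0]
      have hm : (2 : ℝ) ≤ M i j := by
        have : 2 ≤ M i j := by omega
        exact_mod_cast this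
      have hpi := Real.pi_pos
      apply Real.cos_nonneg_of_neg_pi_div_two_le_of_le
      · have : 0 ≤ Real.pi / M i j := by positivity
        linarith
      · exact div_le_div_of_nonneg_left hpi.le (by norm_num) hm
    rw [standardCartan]
    linarith
  mul_eq i j _ _ := by
    rw [standardCartan_comm M j i, standardCartan]; ring
  mul_ge i j h := by
    rw [standardCartan_comm M j i, standardCartan, h]; norm_num
  zero_iff i j := by rw [standardCartan_comm]

/-- The first letter of a reduced word is a left descent, and an element of W_J has no left descent
outside `J`. -/
theorem mem_of_mem_isReduced {J : Set B} {v : W} (hv : v ∈ parabolic cs J) {a : List B}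
    (ha : cs.IsReduced a) (hav : cs.wordProd a = v) {i : B} (hi : i ∈ a) : i ∈ J := by
  induction a generalizing v with
  | nil => simp at hi
  | cons b a ih =>
    have h1 : cs.IsReduced a := ha.drop 1
    rw [cs.wordProd_cons] at hav
    have h2 : cs.simple b * v = cs.wordProd a := by
      rw [← hav, cs.simple_mul_simple_cancel_left]
    have hd : cs.IsLeftDescent v b := by
      rw [cs.isLeftDescent_iff, h2, h1.eq, ← hav, ← cs.wordProd_cons, ha.eq, List.length_cons]
    have hb : b ∈ J := by
      by_contra h
      exact not_isLeftDescent_of_mem_parabolic cs hv h (isGeneralizedCartan_standardCartan M) hd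
    rcases List.mem_cons.mp hi with rfl | hi
    · exact hb
    · exact ih (mul_mem (simple_mem_parabolic cs hb) hv) h1 h2.symm hi

/-! ### Commutation classes of words -/

/-- Two words differ by the exchange of two adjacent letters that commute. -/
def CommSwap (A : Matrix B B ℝ) (l l' : List B) : Prop :=
  ∃ x y a b, A a b = 0 ∧ l = x ++ a :: b :: y ∧ l' = x ++ b :: a :: y

theorem reflRep_simple_simpleRoot_of_eq_zero {a b : B} (h : A a b = 0) :
    reflRep cs hA (cs.simple a) (simpleRoot b) = simpleRoot b := by
  rw [reflRep_simple_simpleRoot, h, zero_smul, sub_zero]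

include hA in
theorem simple_mul_simple_comm {a b : B} (h : A a b = 0) :
    cs.simple a * cs.simple b = cs.simple b * cs.simple a :=
  mul_simple_eq_simple_mul cs hA one_pos
    (by rw [one_smul, reflRep_simple_simpleRoot_of_eq_zero cs hA h])

include hA in
theorem isLeftDescent_simple_mul_iff {a b : B} (h : A a b = 0) (v : W) :
    cs.IsLeftDescent (cs.simple a * v) b ↔ cs.IsLeftDescent v b := by
  rw [isLeftDescent_iff_nonpos cs hA, isLeftDescent_iff_nonpos cs hA, reflRep_inv_simple_mul,
    reflRep_simple_simpleRoot_of_eq_zero cs hA h]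

/-- A swap away from the front is carried along by the recursion. At the front, s_a fixes α_b and
does not affect whether `b` is a descent, nor the reverse, so the two steps can be performed in
either order. -/
theorem sortableRec_and_coneRoot_swap {a b : B} (h0 : A a b = 0) (l : List B) (v : W) :
    ∀ x y, l = x ++ a :: b :: y →
      (SortableRec cs l v ↔ SortableRec cs (x ++ b :: a :: y) v) ∧
      ∀ r, coneRoot cs hA l v r = coneRoot cs hA (x ++ b :: a :: y) v r := by
  induction l, v using word_length_induction cs with
  | ind l v ih1 ih2 =>
    rintro x y rfl
    have h0' := (hA.zero_iff a b).mp h0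
    have hab : a ≠ b := by
      rintro rfl
      rw [hA.diag] at h0
      norm_num at h0
    cases x with
    | cons d x =>
      simp only [List.cons_append]
      by_cases hd : cs.IsLeftDescent v d
      · obtain ⟨i1, i2⟩ := ih2 (x ++ a :: b :: y ++ [d]) (cs.simple d * v) (by simp; omega) hd x
          (y ++ [d]) (by simp)
        rw [sortableRec_cons_of_isLeftDescent cs hd, sortableRec_cons_of_isLeftDescent cs hd, i1]
        refine ⟨by simp, fun r => ?_⟩
        rw [coneRoot_of_isLeftDescent cs hA hd, coneRoot_of_isLeftDescent cs hA hd, i2]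
        simp
      · obtain ⟨i1, i2⟩ := ih1 (x ++ a :: b :: y) v (by simp) x y rfl
        rw [sortableRec_cons_of_not_isLeftDescent cs hd,
          sortableRec_cons_of_not_isLeftDescent cs hd, i1]
        refine ⟨Iff.rfl, fun r => ?_⟩
        rcases eq_or_ne r d with rfl | hr
        · rw [coneRoot_self_of_not_isLeftDescent cs hA hd,
            coneRoot_self_of_not_isLeftDescent cs hA hd]
        · rw [coneRoot_of_not_isLeftDescent cs hA hd hr, coneRoot_of_not_isLeftDescent cs hA hd hr,
            i2]
    | nil =>
      simp only [List.nil_append]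
      have hda := isLeftDescent_simple_mul_iff cs hA h0 v
      have hdb := isLeftDescent_simple_mul_iff cs hA h0' v
      by_cases ha : cs.IsLeftDescent v a <;> by_cases hb : cs.IsLeftDescent v b
      · have hb' := hda.mpr hb
        have ha' := hdb.mpr ha
        have hcomm : cs.simple b * (cs.simple a * v) = cs.simple a * (cs.simple b * v) := by
          rw [← mul_assoc, ← mul_assoc, simple_mul_simple_comm cs hA h0]
        have hlt : cs.length (cs.simple b * (cs.simple a * v)) < cs.length v := lt_trans hb' ha
        -- After both letters are rotated to the end, the same swap is left there, for a shorter
        -- element.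
        obtain ⟨i1, i2⟩ := ih2 (y ++ [a] ++ [b]) (cs.simple b * (cs.simple a * v)) (by simp) hlt y
          [] (by simp)
        rw [sortableRec_cons_of_isLeftDescent cs ha, sortableRec_cons_of_isLeftDescent cs hb,
          List.cons_append, List.cons_append, sortableRec_cons_of_isLeftDescent cs hb',
          sortableRec_cons_of_isLeftDescent cs ha', i1, hcomm]
        refine ⟨by simp, fun r => ?_⟩
        rw [coneRoot_of_isLeftDescent cs hA ha, coneRoot_of_isLeftDescent cs hA hb,
          List.cons_append, List.cons_append, coneRoot_of_isLeftDescent cs hA hb',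
          coneRoot_of_isLeftDescent cs hA ha', i2, hcomm, ← reflRep_mul, ← reflRep_mul,
          simple_mul_simple_comm cs hA h0]
        simp
      · have hb' := mt hda.mp hb
        rw [sortableRec_cons_of_isLeftDescent cs ha, sortableRec_cons_of_not_isLeftDescent cs hb,
          List.cons_append, sortableRec_cons_of_not_isLeftDescent cs hb',
          sortableRec_cons_of_isLeftDescent cs ha]
        refine ⟨Iff.rfl, fun r => ?_⟩
        rw [coneRoot_of_isLeftDescent cs hA ha, List.cons_append]
        rcases eq_or_ne r b with rfl | hr
        · rw [coneRoot_self_of_not_isLeftDescent cs hA hb',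
            coneRoot_self_of_not_isLeftDescent cs hA hb,
            reflRep_simple_simpleRoot_of_eq_zero cs hA h0]
        · rw [coneRoot_of_not_isLeftDescent cs hA hb' hr, coneRoot_of_not_isLeftDescent cs hA hb hr,
            coneRoot_of_isLeftDescent cs hA ha]
      · have ha' := mt hdb.mp ha
        rw [sortableRec_cons_of_not_isLeftDescent cs ha, sortableRec_cons_of_isLeftDescent cs hb,
          sortableRec_cons_of_isLeftDescent cs hb, List.cons_append,
          sortableRec_cons_of_not_isLeftDescent cs ha']
        refine ⟨Iff.rfl, fun r => ?_⟩
        rw [coneRoot_of_isLeftDescent cs hA (l := a :: y) hb, List.cons_append]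
        rcases eq_or_ne r a with rfl | hr
        · rw [coneRoot_self_of_not_isLeftDescent cs hA ha,
            coneRoot_self_of_not_isLeftDescent cs hA ha',
            reflRep_simple_simpleRoot_of_eq_zero cs hA h0']
        · rw [coneRoot_of_not_isLeftDescent cs hA ha hr, coneRoot_of_not_isLeftDescent cs hA ha' hr,
            coneRoot_of_isLeftDescent cs hA hb]
      · rw [sortableRec_cons_of_not_isLeftDescent cs ha,
          sortableRec_cons_of_not_isLeftDescent cs hb,
          sortableRec_cons_of_not_isLeftDescent cs hb, sortableRec_cons_of_not_isLeftDescent cs ha]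
        refine ⟨Iff.rfl, fun r => ?_⟩
        rcases eq_or_ne r a with rfl | hra
        · rw [coneRoot_self_of_not_isLeftDescent cs hA ha,
            coneRoot_of_not_isLeftDescent cs hA hb hab,
            coneRoot_self_of_not_isLeftDescent cs hA ha]
        · rw [coneRoot_of_not_isLeftDescent cs hA ha hra]
          rcases eq_or_ne r b with rfl | hrb
          · rw [coneRoot_self_of_not_isLeftDescent cs hA hb,
              coneRoot_self_of_not_isLeftDescent cs hA hb]
          · rw [coneRoot_of_not_isLeftDescent cs hA hb hrb,
              coneRoot_of_not_isLeftDescent cs hA hb hrb,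
              coneRoot_of_not_isLeftDescent cs hA ha hra]

theorem sortableRec_and_coneRoot_of_reflTransGen {l l' : List B}
    (h : Relation.ReflTransGen (CommSwap A) l l') (v : W) :
    (SortableRec cs l v ↔ SortableRec cs l' v) ∧
      ∀ r, coneRoot cs hA l v r = coneRoot cs hA l' v r := by
  induction h with
  | refl => exact ⟨Iff.rfl, fun _ => rfl⟩
  | tail _ hs ih =>
    obtain ⟨x, y, a, b, h0, rfl, rfl⟩ := hs
    obtain ⟨i1, i2⟩ := sortableRec_and_coneRoot_swap cs hA h0 _ v x y rfl
    exact ⟨ih.1.trans i1, fun r => (ih.2 r).trans (i2 r)⟩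

theorem reflTransGen_commSwap_cons (s : B) {l l' : List B}
    (h : Relation.ReflTransGen (CommSwap A) l l') :
    Relation.ReflTransGen (CommSwap A) (s :: l) (s :: l') := by
  refine Relation.ReflTransGen.lift (p := CommSwap A) (List.cons s) (fun _ _ hs => ?_) _ _ h
  obtain ⟨x, y, a, b, h0, rfl, rfl⟩ := hs
  exact ⟨s :: x, y, a, b, h0, rfl, rfl⟩

theorem reflTransGen_commSwap_move {s : B} {x : List B} (y : List B) (h : ∀ i ∈ x, A s i = 0) :
    Relation.ReflTransGen (CommSwap A) (s :: (x ++ y)) (x ++ s :: y) := by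
  induction x with
  | nil => exact .refl
  | cons a x ih =>
    rw [List.forall_mem_cons] at h
    refine Relation.ReflTransGen.head ⟨[], x ++ y, s, a, h.1, rfl, rfl⟩ ?_
    exact reflTransGen_commSwap_cons a (ih h.2)

theorem wordProd_mem_parabolic (l : List B) : cs.wordProd l ∈ parabolic cs {i | i ∈ l} := by
  induction l with
  | nil => rw [cs.wordProd_nil]; exact one_mem _
  | cons s l ih =>
    rw [cs.wordProd_cons]
    exact mul_mem (simple_mem_parabolic cs List.mem_cons_self)
      (parabolic_mono cs (letters_subset_cons s l) ih)

theorem eq_zero_of_reflRep_wordProd_eq {s : B} {x : List B} (hx : x.Nodup) (hs : s ∉ x)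
    (h : reflRep cs hA (cs.wordProd x) (simpleRoot s) = simpleRoot s) : ∀ i ∈ x, A i s = 0 := by
  induction x with
  | nil => simp
  | cons a x ih =>
    obtain ⟨hax, hx'⟩ := List.nodup_cons.mp hx
    have hsa : s ≠ a := fun h => hs (h ▸ List.mem_cons_self)
    rw [cs.wordProd_cons, reflRep_mul] at h
    have h1 := congrArg (reflRep cs hA (cs.simple a)) h
    rw [reflRep_simple_simple, reflRep_simple_simpleRoot] at h1
    -- The remaining letters leave the coordinate at `a` at 0, while the right-hand side has
    -- coordinate -a_as there.
    have h2 := DFunLike.congr_fun h1 a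
    rw [reflRep_apply_of_notMem cs hA (wordProd_mem_parabolic cs x) (J := {i | i ∈ x}) hax,
      simpleRoot_apply_of_ne hsa, Finsupp.sub_apply, Finsupp.smul_apply, simpleRoot_apply_of_ne hsa,
      simpleRoot_apply_self, smul_eq_mul, mul_one, zero_sub, zero_eq_neg] at h2
    rw [h2, zero_smul, sub_zero] at h1
    rw [List.forall_mem_cons]
    exact ⟨h2, ih hx' (fun h => hs (List.mem_cons_of_mem a h)) h1⟩

include hA in
-- Let z = x⁻¹ α_s, a positive root with coordinate 1 at `s`. As `s` is initial in the common
-- product, y⁻¹ s z ≤ 0; neither `s` nor the letters of `y` touch the coordinates in `x`, so these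
-- vanish and z = α_s. Thus the product of `x` fixes α_s, which forces each letter of `x` to commute
-- with `s`.
theorem commute_of_wordProd_eq {s : B} {l x y : List B} (hl : (s :: l).Nodup)
    (hxy : (x ++ s :: y).Nodup) (h : cs.wordProd (s :: l) = cs.wordProd (x ++ s :: y)) :
    ∀ i ∈ x, A i s = 0 := by
  rw [List.nodup_append] at hxy
  obtain ⟨hx, hsy, hdisj⟩ := hxy
  have hsx : s ∉ x := fun hs => hdisj s hs s List.mem_cons_self rfl
  have hsl := (List.nodup_cons.mp hl).1
  set z := reflRep cs hA (cs.wordProd x)⁻¹ (simpleRoot s) with hz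
  have hzroot := (isRoot_simpleRoot (cs := cs) (hA := hA) s).map (cs.wordProd x)⁻¹
  have hxinv := inv_mem (wordProd_mem_parabolic cs x)
  have hz0 : 0 ≤ z := by
    apply hzroot.nonneg_of_apply_pos (i := s)
    rw [reflRep_apply_of_notMem cs hA hxinv (J := {i | i ∈ x}) hsx, simpleRoot_apply_self]
    exact one_pos
  have hneg : reflRep cs hA (cs.wordProd y)⁻¹ (reflRep cs hA (cs.simple s) z) ≤ 0 := by
    have h1 : reflRep cs hA (cs.wordProd (s :: l))⁻¹ (simpleRoot s) ≤ 0 := by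
      rw [← isLeftDescent_iff_nonpos, cs.wordProd_cons,
        cs.isLeftDescent_iff_not_isLeftDescent_mul, cs.simple_mul_simple_cancel_left]
      exact not_isLeftDescent_of_mem_parabolic cs (wordProd_mem_parabolic cs l) hsl hA
    rw [h, cs.wordProd_append, cs.wordProd_cons, mul_inv_rev, reflRep_mul,
      reflRep_inv_simple_mul] at h1
    exact h1
  have hzs : z = simpleRoot s := by
    have hzz : ∀ i, s ≠ i → z i = 0 := by
      intro i hi
      by_cases hix : i ∈ x
      · refine le_antisymm ?_ (hz0 i)
        have h1 := hneg i
        have hiy : i ∉ y := fun hy => hdisj i hix i (List.mem_cons_of_mem s hy) rfl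
        rwa [reflRep_apply_of_notMem cs hA (inv_mem (wordProd_mem_parabolic cs y))
          (J := {i | i ∈ y}) hiy, reflRep_simple_apply_of_ne cs hA hi] at h1
      · rw [hz, reflRep_apply_of_notMem cs hA hxinv (J := {i | i ∈ x}) hix,
          simpleRoot_apply_of_ne hi]
    rw [eq_smul_simpleRoot hzz, hz, reflRep_apply_of_notMem cs hA hxinv (J := {i | i ∈ x}) hsx,
      simpleRoot_apply_self, one_smul]
  refine eq_zero_of_reflRep_wordProd_eq cs hA hx hsx ?_
  conv_lhs => rw [← hzs, hz]
  exact reflRep_reflRep_inv cs hA _ _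

include hA in
/-- Two words without repetitions, with the same letters and the same product, differ by
commutations. -/
theorem reflTransGen_commSwap_of_wordProd_eq {l l' : List B} (hl : l.Nodup) (hl' : l'.Nodup)
    (hmem : ∀ i, i ∈ l ↔ i ∈ l') (h : cs.wordProd l = cs.wordProd l') :
    Relation.ReflTransGen (CommSwap A) l l' := by
  induction l generalizing l' with
  | nil =>
    have : l' = [] := List.eq_nil_iff_forall_not_mem.mpr fun i hi => by
      simpa using (hmem i).mpr hi
    rw [this]
  | cons s l ih =>
    obtain ⟨x, y, rfl⟩ := List.append_of_mem ((hmem s).mp List.mem_cons_self)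
    have hcomm := commute_of_wordProd_eq cs hA hl hl' h
    have hperm : (x ++ s :: y).Perm (s :: (x ++ y)) := List.perm_middle
    have hnd : (s :: (x ++ y)).Nodup := hperm.nodup_iff.mp hl'
    have hw : cs.wordProd (x ++ s :: y) = cs.wordProd (s :: (x ++ y)) := by
      clear h hmem hl' hperm hnd
      induction x with
      | nil => rfl
      | cons a x ihx =>
        rw [List.forall_mem_cons] at hcomm
        rw [List.cons_append, cs.wordProd_cons, ihx hcomm.2, cs.wordProd_cons, cs.wordProd_cons,
          List.cons_append, cs.wordProd_cons, ← mul_assoc, ← mul_assoc,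
          simple_mul_simple_comm cs hA hcomm.1]
    refine (reflTransGen_commSwap_cons s (ih (List.nodup_cons.mp hl).2
      (List.nodup_cons.mp hnd).2 (fun i => ?_) ?_)).trans
      (reflTransGen_commSwap_move y fun i hi => (hA.zero_iff i s).mp (hcomm i hi))
    · have h1 := hmem i
      rw [hperm.mem_iff, List.mem_cons, List.mem_cons] at h1
      rcases eq_or_ne i s with rfl | his
      · exact iff_of_false (List.nodup_cons.mp hl).1 (List.nodup_cons.mp hnd).1
      · simpa [his] using h1
    · rw [hw, cs.wordProd_cons, cs.wordProd_cons] at h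
      exact mul_left_cancel h

theorem IsCoxeterWord.sortableRec_and_coneRoot {c : W} {l l' : List B}
    (hl : IsCoxeterWord cs c l) (hl' : IsCoxeterWord cs c l') (v : W) :
    (SortableRec cs l v ↔ SortableRec cs l' v) ∧
      ∀ r, coneRoot cs hA l v r = coneRoot cs hA l' v r :=
  sortableRec_and_coneRoot_of_reflTransGen cs hA
    (reflTransGen_commSwap_of_wordProd_eq cs hA hl.1 hl'.1
      (fun i => iff_of_true (hl.2.1 i) (hl'.2.1 i)) (hl.2.2.trans hl'.2.2.symm)) v

end Commutation


/-! ### Sorting words, sortability and skips in terms of the recursion. -/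

section SortingWords

variable {B W : Type*} [Group W] {M : CoxeterMatrix B} (cs : CoxeterSystem M W)

/-! ### Letters of periodic words -/

theorem periodicLetter_of_ne_nil {l : List B} (hl : l ≠ []) (k : ℕ) :
    periodicLetter l k = some (l[k % l.length]'(Nat.mod_lt _ (List.length_pos_iff.mpr hl))) := by
  rw [periodicLetter, List.getElem?_eq_getElem]

theorem periodicLetter_nil (k : ℕ) : periodicLetter ([] : List B) k = none := rfl

theorem ne_nil_of_periodicLetter_eq_some {l : List B} {k : ℕ} {r : B}
    (h : periodicLetter l k = some r) : l ≠ [] := by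
  rintro rfl
  simp [periodicLetter_nil] at h

theorem mem_of_periodicLetter_eq_some {l : List B} {k : ℕ} {r : B}
    (h : periodicLetter l k = some r) : r ∈ l :=
  List.mem_of_getElem? h

theorem periodicLetter_add_length (l : List B) (k : ℕ) :
    periodicLetter l (k + l.length) = periodicLetter l k := by
  rw [periodicLetter, periodicLetter, Nat.add_mod_right]

theorem periodicLetter_rotate (s : B) (l : List B) (k : ℕ) :
    periodicLetter (l ++ [s]) k = periodicLetter (s :: l) (k + 1) := by
  rw [periodicLetter, periodicLetter, List.length_append, List.length_singleton, List.length_cons,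
    Nat.add_mod k 1]
  have hlt : k % (l.length + 1) < l.length + 1 := Nat.mod_lt _ (Nat.succ_pos _)
  generalize k % (l.length + 1) = j at hlt
  rcases Nat.lt_or_ge j l.length with h | h
  · have h1 : 1 % (l.length + 1) = 1 := Nat.mod_eq_of_lt (by omega)
    rw [h1, Nat.mod_eq_of_lt (by omega : j + 1 < l.length + 1), List.getElem?_append_left h,
      List.getElem?_cons_succ]
  · obtain rfl : j = l.length := by omega
    rw [Nat.add_mod_mod, Nat.mod_self, List.getElem?_cons_zero]
    simp

theorem periodicLetter_cons_eq_some_iff {s : B} {l : List B} (hs : s ∉ l) (k : ℕ) :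
    periodicLetter (s :: l) k = some s ↔ k % (l.length + 1) = 0 := by
  rw [periodicLetter, List.length_cons]
  cases hj : k % (l.length + 1) with
  | zero => simp
  | succ j =>
    rw [List.getElem?_cons_succ]
    exact iff_of_false (fun h => hs (List.mem_of_getElem? h)) (by simp)

/-- The position in the periodic word of `s :: l` that corresponds to position `k` in the periodic
word of `l`. -/
def insertPos (n k : ℕ) : ℕ := k + k / n + 1

theorem insertPos_strictMono (n : ℕ) : StrictMono (insertPos n) := fun a b h => by
  have := Nat.div_le_div_right (c := n) h.le
  simp only [insertPos]
  omega

theorem insertPos_mod {n : ℕ} (hn : 0 < n) (k : ℕ) :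
    insertPos n k % (n + 1) = k % n + 1 := by
  have h := Nat.mod_add_div k n
  have hlt := Nat.mod_lt k hn
  have : insertPos n k = (k % n + 1) + (n + 1) * (k / n) := by
    rw [insertPos]
    linear_combination -h
  rw [this, Nat.add_mul_mod_self_left, Nat.mod_eq_of_lt (by omega)]

theorem insertPos_add {n : ℕ} (hn : 0 < n) (k : ℕ) :
    insertPos n (k + n) = insertPos n k + (n + 1) := by
  rw [insertPos, insertPos, Nat.add_div_right _ hn]
  omega

theorem exists_insertPos_eq {n m : ℕ} (h : m % (n + 1) ≠ 0) : ∃ k, insertPos n k = m := by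
  have h1 := Nat.mod_add_div m (n + 1)
  have h2 := Nat.mod_lt m (Nat.succ_pos n)
  generalize m % (n + 1) = j at *
  generalize m / (n + 1) = q at *
  obtain ⟨j, rfl⟩ := Nat.exists_eq_succ_of_ne_zero h
  refine ⟨j + n * q, ?_⟩
  have hn : 0 < n := by omega
  rw [insertPos, Nat.add_mul_div_left _ _ hn, Nat.div_eq_of_lt (by omega), ← h1, Nat.succ_eq_add_one]
  ring

theorem periodicLetter_insertPos (s : B) {l : List B} (hl : l ≠ []) (k : ℕ) :
    periodicLetter (s :: l) (insertPos l.length k) = periodicLetter l k := by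
  rw [periodicLetter, List.length_cons, insertPos_mod (List.length_pos_iff.mpr hl),
    List.getElem?_cons_succ, periodicLetter]

/-! ### Lexicographic order on lists of positions -/

theorem list_le_iff (p q : List ℕ) : p ≤ q ↔ p = q ∨ List.Lex (· < ·) p q := Iff.rfl

theorem nil_list_le (q : List ℕ) : [] ≤ q := by
  cases q with
  | nil => exact Or.inl rfl
  | cons b q => exact Or.inr .nil

theorem not_cons_list_le_nil (a : ℕ) (p : List ℕ) : ¬ a :: p ≤ [] := by
  rw [list_le_iff]
  rintro (h | h)
  · cases h
  · cases h

theorem cons_list_le_cons_iff {a b : ℕ} {p q : List ℕ} :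
    a :: p ≤ b :: q ↔ a < b ∨ a = b ∧ p ≤ q := by
  rw [list_le_iff, list_le_iff, List.cons_lex_cons_iff, List.cons_eq_cons]
  tauto

theorem map_le_map_iff {f : ℕ → ℕ} (hf : StrictMono f) {p q : List ℕ} :
    p.map f ≤ q.map f ↔ p ≤ q := by
  induction p generalizing q with
  | nil => exact iff_of_true (nil_list_le _) (nil_list_le _)
  | cons a p ih =>
    cases q with
    | nil => exact iff_of_false (not_cons_list_le_nil _ _) (not_cons_list_le_nil _ _)
    | cons b q =>
      simp only [List.map_cons, cons_list_le_cons_iff, ih, hf.lt_iff_lt, hf.injective.eq_iff]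

/-- The lexicographic order on all lists of naturals is not well-founded; fixed length makes it so,
by minimising the first entry and recursing. -/
theorem exists_lex_least {k : ℕ} {P : Set (List ℕ)} (hP : P.Nonempty)
    (hk : ∀ p ∈ P, p.length = k) : ∃ p ∈ P, ∀ q ∈ P, p ≤ q := by
  induction k generalizing P with
  | zero =>
    obtain ⟨p, hp⟩ := hP
    refine ⟨p, hp, fun q _ => ?_⟩
    rw [List.length_eq_zero_iff.mp (hk p hp)]
    exact nil_list_le q
  | succ k ih =>
    classical
    have hne : ∃ a, ∃ p, a :: p ∈ P := by
      obtain ⟨p, hp⟩ := hP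
      cases p with
      | nil => simpa using hk _ hp
      | cons a p => exact ⟨a, p, hp⟩
    obtain ⟨p, hp, hmin⟩ := ih (P := {p | Nat.find hne :: p ∈ P}) (Nat.find_spec hne)
      fun p hp => by simpa using hk _ hp
    refine ⟨_, hp, fun q hq => ?_⟩
    cases q with
    | nil => simpa using hk _ hq
    | cons b q =>
      rw [cons_list_le_cons_iff]
      rcases (Nat.find_min' hne ⟨q, hq⟩).lt_or_eq with h | h
      · exact Or.inl h
      · exact Or.inr ⟨h, hmin q (by rw [Set.mem_ofPred_eq, h]; exact hq)⟩

/-! ### Existence of sorting words -/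

theorem exists_positions {l a : List B} (h : ∀ i ∈ a, i ∈ l) (N : ℕ) :
    ∃ p : List ℕ, p.Pairwise (· < ·) ∧ (∀ k ∈ p, N ≤ k) ∧
      p.map (periodicLetter l) = a.map some := by
  induction a generalizing N with
  | nil => exact ⟨[], by simp⟩
  | cons i a ih =>
    rw [List.forall_mem_cons] at h
    obtain ⟨j, hj, hji⟩ := List.getElem_of_mem h.1
    -- The letter is taken from copy number `N` of `l`, which starts no earlier than position `N`
    -- because `l` is nonempty.
    obtain ⟨p, hp, hN, hmap⟩ := ih h.2 (j + l.length * N + 1)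
    have hle : N ≤ j + l.length * N := by
      have : 1 * N ≤ l.length * N := Nat.mul_le_mul_right N (by omega)
      omega
    refine ⟨(j + l.length * N) :: p, List.pairwise_cons.mpr ⟨fun k hk => ?_, hp⟩, ?_, ?_⟩
    · have := hN k hk; omega
    · intro k hk
      rcases List.mem_cons.mp hk with rfl | hk
      · exact hle
      · have := hN k hk; omega
    · rw [List.map_cons, List.map_cons, hmap, periodicLetter, Nat.add_mul_mod_self_left,
        Nat.mod_eq_of_lt hj, List.getElem?_eq_getElem hj, hji]

theorem exists_isReducedSubword {l : List B} {v : W} (hv : v ∈ parabolic cs {i | i ∈ l}) :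
    ∃ p a, IsReducedSubword cs l v p a := by
  obtain ⟨a, ha, rfl⟩ := cs.exists_isReduced v
  obtain ⟨p, hp, -, hmap⟩ := exists_positions (fun i hi => mem_of_mem_isReduced cs hv ha rfl hi) 0
  exact ⟨p, a, hp, hmap, ha, rfl⟩

variable {cs}

theorem IsReducedSubword.length_eq {l : List B} {v : W} {p : List ℕ} {a : List B}
    (h : IsReducedSubword cs l v p a) : p.length = a.length := by
  simpa using congrArg List.length h.2.1

theorem IsReducedSubword.exists_mem {l : List B} {v : W} {p : List ℕ} {a : List B}
    (h : IsReducedSubword cs l v p a) {k : ℕ} (hk : k ∈ p) :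
    ∃ i ∈ a, periodicLetter l k = some i := by
  have : periodicLetter l k ∈ a.map some := h.2.1 ▸ List.mem_map_of_mem hk
  obtain ⟨i, hi, he⟩ := List.mem_map.mp this
  exact ⟨i, hi, he.symm⟩

theorem IsReducedSubword.exists_pos {l : List B} {v : W} {p : List ℕ} {a : List B}
    (h : IsReducedSubword cs l v p a) {i : B} (hi : i ∈ a) :
    ∃ k ∈ p, periodicLetter l k = some i := by
  have : some i ∈ p.map (periodicLetter l) := h.2.1 ▸ List.mem_map_of_mem hi
  exact List.mem_map.mp this

variable (cs)

theorem exists_isSortingWord {l : List B} {v : W} (hv : v ∈ parabolic cs {i | i ∈ l}) :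
    ∃ p a, IsSortingWord cs l v p a := by
  obtain ⟨p, ⟨a, ha⟩, hmin⟩ := exists_lex_least (k := cs.length v)
    (P := {p | ∃ a, IsReducedSubword cs l v p a}) (exists_isReducedSubword cs hv) (by
      rintro p ⟨a, ha⟩
      rw [ha.length_eq, ← ha.2.2.1.eq, ha.2.2.2])
  exact ⟨p, a, ha, fun q b hb => hmin q ⟨b, hb⟩⟩

variable {cs}

/-! ### Recursion for sorting words -/

theorem pairwise_lt_map_iff {f : ℕ → ℕ} (hf : StrictMono f) {p : List ℕ} :
    (p.map f).Pairwise (· < ·) ↔ p.Pairwise (· < ·) := by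
  rw [List.pairwise_map]
  simp only [hf.lt_iff_lt]

theorem succ_strictMono : StrictMono (fun k : ℕ => k + 1) := fun _ _ h => Nat.succ_lt_succ h

theorem map_periodicLetter_rotate (s : B) (l : List B) (p : List ℕ) :
    (p.map fun k => k + 1).map (periodicLetter (s :: l)) =
      p.map (periodicLetter (l ++ [s])) := by
  rw [List.map_map]
  exact List.map_congr_left fun k _ => (periodicLetter_rotate s l k).symm

theorem IsReducedSubword.cons {s : B} {l : List B} {v : W} {p : List ℕ} {a : List B}
    (h : IsReducedSubword cs (l ++ [s]) (cs.simple s * v) p a) (hs : cs.IsLeftDescent v s) :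
    IsReducedSubword cs (s :: l) v (0 :: p.map fun k => k + 1) (s :: a) := by
  obtain ⟨h1, h2, h3, h4⟩ := h
  have hw : cs.wordProd (s :: a) = v := by
    rw [cs.wordProd_cons, h4, cs.simple_mul_simple_cancel_left]
  refine ⟨List.pairwise_cons.mpr ⟨?_, (pairwise_lt_map_iff succ_strictMono).mpr h1⟩, ?_, ?_, hw⟩
  · intro k hk
    obtain ⟨j, -, rfl⟩ := List.mem_map.mp hk
    exact Nat.succ_pos j
  · rw [List.map_cons, map_periodicLetter_rotate, h2, List.map_cons]
    rfl
  · rw [CoxeterSystem.IsReduced, hw, List.length_cons, ← h3.eq, h4, cs.isLeftDescent_iff.mp hs]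

theorem IsReducedSubword.of_cons {s : B} {l : List B} {v : W} {q : List ℕ} {b : List B}
    (h : IsReducedSubword cs (s :: l) v (0 :: q) b) :
    ∃ p a, q = p.map (fun k => k + 1) ∧ b = s :: a ∧ cs.IsLeftDescent v s ∧
      IsReducedSubword cs (l ++ [s]) (cs.simple s * v) p a := by
  obtain ⟨h1, h2, h3, h4⟩ := h
  cases b with
  | nil => simp at h2
  | cons i a =>
    rw [List.map_cons, List.map_cons, List.cons_eq_cons] at h2
    obtain ⟨h5, h6⟩ := h2
    obtain rfl : s = i := by simpa [periodicLetter] using h5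
    obtain ⟨h7, h8⟩ := List.pairwise_cons.mp h1
    have hq : (q.map fun k => k - 1).map (fun k => k + 1) = q := by
      rw [List.map_map]
      conv_rhs => rw [← List.map_id q]
      refine List.map_congr_left fun k hk => ?_
      have := h7 k hk
      simp only [Function.comp_apply, id]
      omega
    have hred : cs.IsReduced a := h3.drop 1
    have hsv : cs.wordProd a = cs.simple s * v := by
      rw [← h4, cs.wordProd_cons, cs.simple_mul_simple_cancel_left]
    refine ⟨q.map fun k => k - 1, a, hq.symm, rfl, ?_, ?_, ?_, hred, hsv⟩
    · rw [cs.isLeftDescent_iff, ← hsv, hred.eq, ← h4, h3.eq, List.length_cons]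
    · rw [← pairwise_lt_map_iff succ_strictMono, hq]
      exact h8
    · rw [← map_periodicLetter_rotate, hq, h6]

/-- When `v ≥ s` some reduced subword starts at position 0, so the lexicographically first one does
too; shifting positions by one preserves the lexicographic order. -/
theorem IsSortingWord.exists_eq_cons {s : B} {l : List B} {v : W} {p : List ℕ} {a : List B}
    (h : IsSortingWord cs (s :: l) v p a) (hs : cs.IsLeftDescent v s)
    (hv : v ∈ parabolic cs {i | i ∈ s :: l}) :
    ∃ p' a', p = 0 :: p'.map (fun k => k + 1) ∧ a = s :: a' ∧
      IsSortingWord cs (l ++ [s]) (cs.simple s * v) p' a' := by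
  obtain ⟨q, b, hq⟩ := exists_isReducedSubword cs (l := l ++ [s]) (v := cs.simple s * v) (by
    rw [letters_rotate]
    exact mul_mem (simple_mem_parabolic cs List.mem_cons_self) hv)
  have hle := h.2 _ _ (hq.cons hs)
  have hlen := h.1.length_eq
  cases p with
  | nil =>
    obtain rfl : a = [] := List.length_eq_zero_iff.mp hlen.symm
    have hv1 : v = 1 := by rw [← h.1.2.2.2, cs.wordProd_nil]
    exact absurd (hv1 ▸ hs) (cs.not_isLeftDescent_one s)
  | cons k p =>
    obtain rfl : k = 0 := by
      rw [cons_list_le_cons_iff] at hle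
      omega
    obtain ⟨p', a', rfl, rfl, -, hred⟩ := h.1.of_cons
    refine ⟨p', a', rfl, rfl, hred, fun q' b' hq' => ?_⟩
    have := h.2 _ _ (hq'.cons hs)
    rw [cons_list_le_cons_iff] at this
    simpa [map_le_map_iff succ_strictMono] using this

theorem IsReducedSubword.insert {s : B} {l : List B} {v : W} {p : List ℕ} {a : List B}
    (h : IsReducedSubword cs l v p a) :
    IsReducedSubword cs (s :: l) v (p.map (insertPos l.length)) a := by
  refine ⟨(pairwise_lt_map_iff (insertPos_strictMono _)).mpr h.1, ?_, h.2.2⟩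
  rw [← h.2.1, List.map_map]
  refine List.map_congr_left fun k hk => ?_
  obtain ⟨i, -, hi⟩ := h.exists_mem hk
  exact periodicLetter_insertPos s (ne_nil_of_periodicLetter_eq_some hi) k

/-- Without the letter `s`, all positions avoid the multiples of the period. `insertPos` enumerates
the remaining positions increasingly, so it preserves and reflects lexicographic minimality. -/
theorem IsSortingWord.exists_eq_map {s : B} {l : List B} {v : W} {p : List ℕ} {a : List B}
    (h : IsSortingWord cs (s :: l) v p a) (hsl : s ∉ l) (hsa : s ∉ a) :
    ∃ p', p = p'.map (insertPos l.length) ∧ IsSortingWord cs l v p' a := by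
  have hmod : ∀ k ∈ p, k % (l.length + 1) ≠ 0 := by
    intro k hk h0
    obtain ⟨i, hi, he⟩ := h.1.exists_mem hk
    rw [(periodicLetter_cons_eq_some_iff hsl k).mpr h0, Option.some_inj] at he
    exact hsa (he ▸ hi)
  have hex : ∃ p' : List ℕ, p = p'.map (insertPos l.length) := by
    have : p ∈ Set.range (List.map (insertPos l.length)) := by
      rw [Set.range_list_map]
      exact fun k hk => exists_insertPos_eq (hmod k hk)
    obtain ⟨p', hp'⟩ := this
    exact ⟨p', hp'.symm⟩
  obtain ⟨p', rfl⟩ := hex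
  refine ⟨p', rfl, ⟨(pairwise_lt_map_iff (insertPos_strictMono _)).mp h.1.1, ?_, h.1.2.2⟩,
    fun q b hq => (map_le_map_iff (insertPos_strictMono _)).mp (h.2 _ _ hq.insert)⟩
  rw [← h.1.2.1, List.map_map]
  refine List.map_congr_left fun k hk => ?_
  have hl : l ≠ [] := by
    rintro rfl
    exact hmod _ (List.mem_map_of_mem hk) (by simp [Nat.mod_one])
  exact (periodicLetter_insertPos s hl k).symm

/-! ### Sortable elements satisfy the recursion -/

/-- Nested blocks mean that the set of used positions is closed under subtracting a period. This
form survives both the shift by one and the deletion of the initial letter. -/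
theorem add_length_mem_of_antitone {l : List B} (hl : l.Nodup) {v : W} {p : List ℕ} {a : List B}
    (h : IsReducedSubword cs l v p a) (hp : Antitone (blockLetters l p)) (y : ℕ)
    (hy : y + l.length ∈ p) : y ∈ p := by
  obtain ⟨i, -, hi⟩ := h.exists_mem hy
  have hne := ne_nil_of_periodicLetter_eq_some hi
  have hpos := List.length_pos_iff.mpr hne
  have h1 : i ∈ blockLetters l p (y / l.length + 1) :=
    ⟨_, hy, Nat.add_div_right _ hpos, hi⟩
  obtain ⟨x, hx, hxy, hxi⟩ := hp (Nat.le_succ _) h1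
  rw [periodicLetter_add_length] at hi
  have hmod : x % l.length = y % l.length := by
    rw [periodicLetter_of_ne_nil hne, Option.some_inj] at hi hxi
    exact (hl.getElem_inj_iff).mp (hxi.trans hi.symm)
  have : x = y := by
    rw [← Nat.mod_add_div x l.length, ← Nat.mod_add_div y l.length, hmod, hxy]
  exact this ▸ hx

theorem IsSortingWord.sortableRec {l : List B} {v : W} {p : List ℕ} {a : List B}
    (h : IsSortingWord cs l v p a) (hl : l.Nodup) (hp : ∀ y, y + l.length ∈ p → y ∈ p) :
    SortableRec cs l v := by
  induction l, v using word_length_induction cs generalizing p a with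
  | ind l v ih1 ih2 =>
    have hv : v ∈ parabolic cs {i | i ∈ l} := by
      rw [← h.1.2.2.2]
      refine parabolic_mono cs (fun i hi => ?_) (wordProd_mem_parabolic cs a)
      obtain ⟨k, -, hk⟩ := h.1.exists_pos hi
      exact mem_of_periodicLetter_eq_some hk
    cases l with
    | nil =>
      rw [sortableRec_nil_iff]
      have : a = [] := List.eq_nil_iff_forall_not_mem.mpr fun i hi => by
        obtain ⟨k, -, hk⟩ := h.1.exists_pos hi
        simp [periodicLetter_nil] at hk
      rw [← h.1.2.2.2, this, cs.wordProd_nil]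
    | cons s l =>
      obtain ⟨hsl, hl'⟩ := List.nodup_cons.mp hl
      by_cases hs : cs.IsLeftDescent v s
      · obtain ⟨p', a', rfl, rfl, h'⟩ := h.exists_eq_cons hs hv
        refine .step hs (ih2 _ _ (by simp) hs h' (nodup_rotate hl) fun y hy => ?_)
        have h1 := hp (y + 1) (by
          refine List.mem_cons_of_mem _ (List.mem_map.mpr ⟨_, hy, ?_⟩)
          simp only [List.length_append, List.length_cons, List.length_nil]
          omega)
        simpa using h1
      · have h0 : 0 ∉ p := by
          intro h0
          cases p with
          | nil => simp at h0
          | cons k q =>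
            rcases List.mem_cons.mp h0 with rfl | h0
            · obtain ⟨_, _, _, _, hd, _⟩ := h.1.of_cons
              exact hs hd
            · exact absurd ((List.pairwise_cons.mp h.1.1).1 0 h0) (Nat.not_lt_zero _)
        -- Since `s` is unused in the first copy, closure under subtracting a period excludes it
        -- from all copies.
        have hmul : ∀ m, (l.length + 1) * m ∉ p := by
          intro m
          induction m with
          | zero => simpa using h0
          | succ m ihm => exact fun hm => ihm (hp _ (by rwa [List.length_cons, ← Nat.mul_succ]))
        have hsa : s ∉ a := by
          intro hsa
          obtain ⟨k, hk, hks⟩ := h.1.exists_pos hsa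
          rw [periodicLetter_cons_eq_some_iff hsl] at hks
          refine hmul (k / (l.length + 1)) ?_
          rwa [Nat.mul_div_cancel' (Nat.dvd_of_mod_eq_zero hks)]
        obtain ⟨p', rfl, h'⟩ := h.exists_eq_map hsl hsa
        refine .drop hs (ih1 _ _ (by simp) h' hl' fun y hy => ?_)
        rcases eq_or_ne l [] with rfl | hne
        · exact hy
        · have h1 := hp (insertPos l.length y) (by
            rw [List.length_cons, ← insertPos_add (List.length_pos_iff.mpr hne)]
            exact List.mem_map_of_mem hy)
          exact (List.mem_map_of_injective (insertPos_strictMono _).injective).mp h1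

theorem IsSortable.exists_sortableRec {c v : W} (h : IsSortable cs c v) :
    ∃ l, IsCoxeterWord cs c l ∧ SortableRec cs l v := by
  obtain ⟨l, hl, p, a, hpa, hp⟩ := h
  exact ⟨l, hl, hpa.sortableRec hl.1 (add_length_mem_of_antitone hl.1 hpa.1 hp)⟩

/-! ### Skips and cone roots -/

/-- Both sides obey the same recursion: when `v ≥ s`, the prefix before the skip acquires the letter
`s`; when `s` is dropped, its first skip is at position 0 with empty prefix, and deleting the
positions of `s` does not alter the prefixes for the other letters. -/
theorem SortableRec.reflRep_take_eq_coneRoot {A : Matrix B B ℝ} (hA : IsGeneralizedCartan M A)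
    {l : List B} {v : W} (h : SortableRec cs l v) (hl : l.Nodup) {r : B} (hr : r ∈ l)
    {p : List ℕ} {a : List B} (hpa : IsSortingWord cs l v p a) {x : ℕ}
    (hx : IsLeast {y | periodicLetter l y = some r ∧ y ∉ p} x) :
    reflRep cs hA (cs.wordProd (a.take (p.countP (· < x)))) (simpleRoot r) =
      coneRoot cs hA l v r := by
  induction h generalizing p a x with
  | nil => simp at hr
  | @step s l v h hv ih =>
    obtain ⟨p', a', rfl, rfl, hpa'⟩ := hpa.exists_eq_cons h (SortableRec.step h hv).mem_parabolic
    obtain ⟨⟨hxr, hxp⟩, hmin⟩ := hx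
    obtain ⟨x, rfl⟩ : ∃ x', x = x' + 1 := by
      refine ⟨x - 1, ?_⟩
      have : x ≠ 0 := fun h0 => hxp (h0 ▸ List.mem_cons_self)
      omega
    have hx' : IsLeast {y | periodicLetter (l ++ [s]) y = some r ∧ y ∉ p'} x := by
      refine ⟨⟨by rwa [periodicLetter_rotate], fun hm => hxp ?_⟩, fun y hy => ?_⟩
      · exact List.mem_cons_of_mem _ (List.mem_map.mpr ⟨x, hm, rfl⟩)
      · have : x + 1 ≤ y + 1 := hmin ⟨by rw [← periodicLetter_rotate]; exact hy.1, by
          simpa using hy.2⟩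
        omega
    have hcount : (0 :: p'.map fun k => k + 1).countP (· < x + 1) = p'.countP (· < x) + 1 := by
      rw [List.countP_cons, List.countP_map]
      simp [Function.comp_def]
    rw [hcount, List.take_succ_cons, cs.wordProd_cons, reflRep_mul,
      ih (nodup_rotate hl) (mem_rotate_iff.mpr hr) hpa' hx', coneRoot_of_isLeftDescent cs hA h]
  | @drop s l v h hv ih =>
    obtain ⟨hsl, hl'⟩ := List.nodup_cons.mp hl
    have hsa : s ∉ a := fun hsa =>
      hsl (mem_of_mem_isReduced cs hv.mem_parabolic hpa.1.2.2.1 hpa.1.2.2.2 hsa)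
    obtain ⟨p', rfl, hpa'⟩ := hpa.exists_eq_map hsl hsa
    obtain ⟨⟨hxr, hxp⟩, hmin⟩ := hx
    rcases eq_or_ne r s with rfl | hrs
    · obtain rfl : x = 0 := Nat.le_zero.mp (hmin ⟨by simp [periodicLetter], by simp [insertPos]⟩)
      rw [coneRoot_self_of_not_isLeftDescent cs hA h]
      simp
    · have hr' := List.mem_of_ne_of_mem hrs hr
      have hne : l ≠ [] := List.ne_nil_of_mem hr'
      obtain ⟨x, rfl⟩ : ∃ k, insertPos l.length k = x := by
        apply exists_insertPos_eq
        rw [Ne, ← periodicLetter_cons_eq_some_iff hsl, hxr, Option.some_inj]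
        exact hrs
      have hmem : ∀ y, insertPos l.length y ∈ p'.map (insertPos l.length) ↔ y ∈ p' := fun y =>
        List.mem_map_of_injective (insertPos_strictMono _).injective
      have hx' : IsLeast {y | periodicLetter l y = some r ∧ y ∉ p'} x := by
        refine ⟨⟨by rwa [periodicLetter_insertPos s hne] at hxr, by rwa [hmem] at hxp⟩,
          fun y hy => ?_⟩
        exact (insertPos_strictMono _).le_iff_le.mp
          (hmin ⟨by rw [periodicLetter_insertPos s hne]; exact hy.1, by rw [hmem]; exact hy.2⟩)
      have hcount : (p'.map (insertPos l.length)).countP (· < insertPos l.length x) =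
          p'.countP (· < x) := by
        rw [List.countP_map]
        congr 1
        ext k
        simp [(insertPos_strictMono l.length).lt_iff_lt]
      rw [hcount, ih hl' hr' hpa' hx', coneRoot_of_not_isLeftDescent cs hA h hrs]

theorem exists_isLeast_skip {l : List B} {r : B} (hr : r ∈ l) (p : List ℕ) :
    ∃ x, IsLeast {y | periodicLetter l y = some r ∧ y ∉ p} x := by
  classical
  have hex : ∃ y, periodicLetter l y = some r ∧ y ∉ p := by
    -- The bound `p.sum + 1` exceeds every entry of `p`, so the occurrence found is not in `p`.
    obtain ⟨q, -, hN, hmap⟩ := exists_positions (l := l) (a := [r]) (by simpa using hr)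
      (p.sum + 1)
    obtain ⟨y, rfl⟩ : ∃ y, q = [y] := List.length_eq_one_iff.mp (by
      simpa using congrArg List.length hmap)
    refine ⟨y, by simpa using hmap, fun hy => ?_⟩
    have h1 := hN y (by simp)
    have h2 := List.le_sum_of_mem hy
    omega
  exact ⟨Nat.find hex, Nat.find_spec hex, fun y hy => Nat.find_min' hex hy⟩

end SortingWords


/-! ### From cone roots to covers, unforced skips and chambers. -/

section Fibres

variable {B W : Type*} [Group W] {M : CoxeterMatrix B} (cs : CoxeterSystem M W)
  {A : Matrix B B ℝ} (hA : IsGeneralizedCartan M A)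

/-! ### Covers and unforced skips -/

/-- The positive root of this reflection is -v α_i = (v s_i) α_i, which reverses the sign in the
criterion. -/
theorem isLeftInversion_of_reflRep_simpleRoot_nonpos {v w : W} {i : B}
    (hv : reflRep cs hA v (simpleRoot i) ≤ 0) :
    cs.IsLeftInversion w (v * cs.simple i * v⁻¹) ↔
      0 ≤ reflRep cs hA w⁻¹ (reflRep cs hA v (simpleRoot i)) := by
  have h1 : reflRep cs hA (v * cs.simple i) (simpleRoot i) = -reflRep cs hA v (simpleRoot i) := by
    rw [reflRep_mul, reflRep_simple_self, map_neg]
  have h2 := isLeftInversion_iff_nonpos cs hA (w := w) (y := v * cs.simple i) (r := i)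
    (by rw [h1]; exact neg_nonneg.mpr hv)
  rwa [h1, map_neg, neg_nonpos, cs.simple_mul_simple_cancel_right, mul_inv_rev, cs.inv_simple,
    ← mul_assoc] at h2

theorem mem_cov_iff {v t : W} :
    t ∈ cov cs v ↔ ∃ i, reflRep cs hA v (simpleRoot i) ≤ 0 ∧ t = v * cs.simple i * v⁻¹ := by
  constructor
  · rintro ⟨hinv, i, hi⟩
    have ht : t = v * cs.simple i * v⁻¹ := eq_mul_inv_of_mul_eq hi
    refine ⟨i, ?_, ht⟩
    rw [← isRightDescent_iff_nonpos]
    have := hinv.2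
    rwa [hi] at this
  · rintro ⟨i, hi, rfl⟩
    have h : v * cs.simple i * v⁻¹ * v = v * cs.simple i := by simp
    refine ⟨⟨⟨v, i, rfl⟩, ?_⟩, i, h⟩
    rw [h]
    exact (isRightDescent_iff_nonpos cs hA).mpr hi

variable {cs} in
-- As a prefix of a reduced word, `u` is reduced, so the skip is unforced exactly when `r` is not a
-- right descent of its product.
theorem IsSkip.isReduced_append_iff {l : List B} {v : W} {r : B} {u : List B}
    (h : IsSkip cs l v r u) :
    cs.IsReduced (u ++ [r]) ↔ 0 ≤ reflRep cs hA (cs.wordProd u) (simpleRoot r) := by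
  obtain ⟨p, a, x, hpa, -, rfl⟩ := h
  have hred := hpa.1.2.2.1.take (p.countP (· < x))
  rw [← not_isRightDescent_iff_nonneg, cs.not_isRightDescent_iff, CoxeterSystem.IsReduced,
    cs.wordProd_append, cs.wordProd_singleton, List.length_append, List.length_singleton,
    hred.eq]

/-- The cone roots split by sign: the positive ones are the roots of the unforced skips, and the
negative ones are, up to scaling, the negatives of the roots of the cover reflections. -/
theorem forall_coneRoot_nonneg_iff {δ : B → ℝ} (hpos : ∀ i, 0 < δ i)
    (hδ : ∀ i j, δ i * A i j = δ j * A j i) {c : W} {l : List B} (hl : IsCoxeterWord cs c l)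
    {v : W} (hv : SortableRec cs l v) (w : W) :
    (∀ r ∈ l, 0 ≤ reflRep cs hA w⁻¹ (coneRoot cs hA l v r)) ↔
      cov cs v ⊆ inv cs w ∧ ufs cs c v ∩ inv cs w = ∅ := by
  constructor
  · intro h
    constructor
    · intro t ht
      obtain ⟨i, hi, rfl⟩ := (mem_cov_iff cs hA).mp ht
      refine (isLeftInversion_of_reflRep_simpleRoot_nonpos cs hA hi).mpr ?_
      obtain ⟨r, hr, κ, hκ, he⟩ := hv.exists_coneRoot_eq_smul hA hpos hδ hl.1 hi
      have h1 := h r hr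
      rw [he, map_smul] at h1
      have := smul_nonneg (inv_pos.mpr hκ).le h1
      rwa [inv_smul_smul₀ hκ.ne'] at this
    · rw [Set.eq_empty_iff_forall_notMem]
      rintro t ⟨⟨l', r, u, hl', hskip, hred, rfl⟩, hinv⟩
      have h0 := (hskip.isReduced_append_iff hA).mp hred
      have hneg := (isLeftInversion_iff_nonpos cs hA h0).mp hinv
      -- The skip may come from another reduced word of `c`; sortability and cone roots do not
      -- depend on that choice.
      obtain ⟨hs, hC⟩ := IsCoxeterWord.sortableRec_and_coneRoot cs hA hl hl' v
      obtain ⟨p, a, x, hpa, hx, rfl⟩ := hskip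
      rw [(hs.mp hv).reflRep_take_eq_coneRoot hA hl'.1 (hl'.2.1 r) hpa hx, ← hC] at hneg
      exact ((hv.isRoot_coneRoot hA (hl.2.1 r)).map w⁻¹).not_nonneg_iff.mpr hneg (h r (hl.2.1 r))
  · rintro ⟨hcov, hufs⟩ r hr
    have hroot := hv.isRoot_coneRoot hA hr
    rcases hroot.nonneg_or_nonpos with h0 | h0
    · obtain ⟨p, a, hpa⟩ := exists_isSortingWord cs hv.mem_parabolic
      obtain ⟨x, hx⟩ := exists_isLeast_skip hr p
      have he := hv.reflRep_take_eq_coneRoot hA hl.1 hr hpa hx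
      have hskip : IsSkip cs l v r (a.take (p.countP (· < x))) := ⟨p, a, x, hpa, hx, rfl⟩
      rw [← he] at h0
      rw [← (hroot.map w⁻¹).not_nonpos_iff, ← he, ← isLeftInversion_iff_nonpos cs hA h0]
      intro hinv
      refine (Set.eq_empty_iff_forall_notMem.mp hufs) _ ⟨⟨l, r, _, hl, hskip, ?_, rfl⟩, hinv⟩
      exact (hskip.isReduced_append_iff hA).mpr h0
    · have he := hv.inv_coneRoot_eq_of_nonpos hA hpos hδ hl.1 hr h0
      have he' : coneRoot cs hA l v r = reflRep cs hA v (simpleRoot r) := by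
        rw [← he, reflRep_reflRep_inv]
      rw [he'] at h0 ⊢
      exact (isLeftInversion_of_reflRep_simpleRoot_nonpos cs hA h0).mp
        (hcov ((mem_cov_iff cs hA).mpr ⟨r, h0, rfl⟩))

/-! ### Chambers and Cambrian cones -/

theorem dual_reflRep_apply (w : W) (x : Module.Dual ℝ (B →₀ ℝ)) (y : B →₀ ℝ) :
    (reflRep cs hA).dual w x y = x (reflRep cs hA w⁻¹ y) := by
  rw [Representation.dual_apply]
  rfl

theorem mem_chamber_iff {w : W} {x : Module.Dual ℝ (B →₀ ℝ)} :
    x ∈ chamber cs hA w ↔ ∀ i, 0 ≤ x (reflRep cs hA w (simpleRoot i)) := by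
  constructor
  · rintro ⟨d, hd, rfl⟩ i
    beta_reduce
    rw [dual_reflRep_apply, reflRep_inv_reflRep]
    exact hd i
  · intro h
    refine ⟨(reflRep cs hA).dual w⁻¹ x, fun i => ?_, ?_⟩
    · rw [dual_reflRep_apply, inv_inv]
      exact h i
    · refine LinearMap.ext fun y => ?_
      beta_reduce
      rw [dual_reflRep_apply, dual_reflRep_apply, inv_inv, reflRep_reflRep_inv]

theorem map_eq_sum_simpleRoot {N : Type*} [AddCommMonoid N] [Module ℝ N]
    (f : (B →₀ ℝ) →ₗ[ℝ] N) (y : B →₀ ℝ) : f y = ∑ i ∈ y.support, y i • f (simpleRoot i) := by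
  have e : y = ∑ i ∈ y.support, y i • simpleRoot i := by
    conv_lhs => rw [← Finsupp.sum_single y, Finsupp.sum]
    simp [simpleRoot]
  conv_lhs => rw [e, map_sum]
  simp

theorem chamber_subset_iff {l : List B} {v w : W} :
    chamber cs hA w ⊆ cambrianCone cs hA l v ↔
      ∀ r, 0 ≤ reflRep cs hA w⁻¹ (coneRoot cs hA l v r) := by
  constructor
  · intro h r i
    -- The coordinate functionals lie in the dominant chamber and detect nonnegativity of a vector.
    have hmem : (Finsupp.lapply i : (B →₀ ℝ) →ₗ[ℝ] ℝ) ∈ dominantChamber B := fun j =>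
      simpleRoot_nonneg j i
    have h1 := h ⟨_, hmem, rfl⟩ r
    beta_reduce at h1
    rwa [dual_reflRep_apply] at h1
  · intro h x hx r
    rw [mem_chamber_iff] at hx
    have h1 := map_eq_sum_simpleRoot (x.comp (reflRep cs hA w))
      (reflRep cs hA w⁻¹ (coneRoot cs hA l v r))
    rw [LinearMap.comp_apply, reflRep_reflRep_inv] at h1
    rw [h1]
    exact Finset.sum_nonneg fun i _ => mul_nonneg (h r i) (hx i)

/-- Every point of the Tits cone lies in a chamber `wD` such that `v⁻¹ w α_i` is nonnegative
whenever the wall of `wD` given by `i` contains the point. -/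
theorem exists_mem_chamber {x : Module.Dual ℝ (B →₀ ℝ)} (hx : x ∈ titsCone cs hA) (v : W) :
    ∃ w, x ∈ chamber cs hA w ∧ ∀ i, x (reflRep cs hA w (simpleRoot i)) = 0 →
      0 ≤ reflRep cs hA v⁻¹ (reflRep cs hA w (simpleRoot i)) := by
  have hne : {w | x ∈ chamber cs hA w}.Nonempty := Set.mem_iUnion.mp hx
  -- Among the chambers containing `x`, one nearest to the chamber of `v` is taken.
  let w := Function.argminOn (fun w => cs.length (w⁻¹ * v)) {w | x ∈ chamber cs hA w} hne
  have hw : x ∈ chamber cs hA w :=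
    Function.argminOn_mem (fun w => cs.length (w⁻¹ * v)) {w | x ∈ chamber cs hA w} hne
  refine ⟨w, hw, fun i hi => ?_⟩
  -- A point on the wall of index `i` also lies in the adjacent chamber, so minimality says that s_i
  -- does not shorten w⁻¹v.
  have hw' : w * cs.simple i ∈ {w | x ∈ chamber cs hA w} := by
    rw [Set.mem_ofPred_eq, mem_chamber_iff] at *
    intro j
    rw [reflRep_mul, reflRep_simple_simpleRoot, map_sub, map_smul, map_sub, map_smul, hi, smul_zero,
      sub_zero]
    exact hw j
  have hle : cs.length (w⁻¹ * v) ≤ cs.length ((w * cs.simple i)⁻¹ * v) :=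
    Function.argminOn_le (fun w => cs.length (w⁻¹ * v)) {w | x ∈ chamber cs hA w} hw'
  rw [mul_inv_rev, cs.inv_simple, mul_assoc] at hle
  have h1 := (not_isLeftDescent_iff_nonneg cs hA (w := w⁻¹ * v) (i := i)).mp (not_lt.mpr hle)
  rwa [mul_inv_rev, inv_inv, reflRep_mul] at h1

/-- If w⁻¹C were negative for a cone root C, then -C would be a nonnegative combination of the w
α_i. Since `x` is nonnegative on C and on each w α_i, it vanishes on those that occur. For these
v⁻¹w α_i ≥ 0 by the choice of `w`, so v⁻¹C ≤ 0, contradicting that the root v⁻¹C is nonnegative. -/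
theorem exists_chamber_subset {l : List B} (hl : ∀ i, i ∈ l) {v : W}
    (hv : SortableRec cs l v) {x : Module.Dual ℝ (B →₀ ℝ)} (hx : x ∈ titsCone cs hA)
    (hxC : x ∈ cambrianCone cs hA l v) :
    ∃ w, x ∈ chamber cs hA w ∧ ∀ r, 0 ≤ reflRep cs hA w⁻¹ (coneRoot cs hA l v r) := by
  obtain ⟨w, hw, hwall⟩ := exists_mem_chamber cs hA hx v
  refine ⟨w, hw, fun r => ?_⟩
  rw [mem_chamber_iff] at hw
  have hroot := hv.isRoot_coneRoot hA (hl r)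
  rw [← (hroot.map _).not_nonpos_iff]
  intro hneg
  set y := -reflRep cs hA w⁻¹ (coneRoot cs hA l v r) with hy
  have hy0 : 0 ≤ y := neg_nonneg.mpr hneg
  have hwy : reflRep cs hA w y = -coneRoot cs hA l v r := by
    rw [hy, map_neg, reflRep_reflRep_inv]
  have h1 := map_eq_sum_simpleRoot (x.comp (reflRep cs hA w)) y
  rw [LinearMap.comp_apply, hwy, map_neg] at h1
  have hterm : ∀ i ∈ y.support, 0 ≤ y i • (x.comp (reflRep cs hA w)) (simpleRoot i) :=
    fun i _ => mul_nonneg (hy0 i) (hw i)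
  have hsum : ∑ i ∈ y.support, y i • (x.comp (reflRep cs hA w)) (simpleRoot i) = 0 :=
    le_antisymm (h1 ▸ neg_nonpos.mpr (hxC r)) (Finset.sum_nonneg hterm)
  rw [Finset.sum_eq_zero_iff_of_nonneg hterm] at hsum
  have h2 := map_eq_sum_simpleRoot ((reflRep cs hA v⁻¹).comp (reflRep cs hA w)) y
  rw [LinearMap.comp_apply, hwy, map_neg] at h2
  have h3 : 0 ≤ -reflRep cs hA v⁻¹ (coneRoot cs hA l v r) := by
    rw [h2]
    refine Finset.sum_nonneg fun i hi => smul_nonneg (hy0 i) (hwall i ?_)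
    exact (mul_eq_zero.mp (hsum i hi)).resolve_left (Finsupp.mem_support_iff.mp hi)
  exact (hroot.map v⁻¹).not_nonneg_iff.mpr (neg_nonneg.mp h3) (hv.inv_coneRoot_nonneg hA (hl r))

theorem SortableRec.span_range_coneRoot {δ : B → ℝ} (hpos : ∀ i, 0 < δ i)
    (hδ : ∀ i j, δ i * A i j = δ j * A j i) {l : List B} (hnd : l.Nodup) (hl : ∀ i, i ∈ l) {v : W}
    (hv : SortableRec cs l v) :
    Submodule.span ℝ (Set.range (coneRoot cs hA l v)) = ⊤ := by
  obtain ⟨g, hg, -⟩ := hv.exists_coefficients hA hpos hδ hnd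
  rw [eq_top_iff]
  intro x _
  rw [hg x ((Finsupp.mem_supported' ℝ x).mpr fun i hi => absurd (hl i) hi)]
  refine list_sum_mem fun y hy => ?_
  obtain ⟨r, -, rfl⟩ := List.mem_map.mp hy
  exact Submodule.smul_mem _ _ (Submodule.subset_span ⟨r, rfl⟩)

theorem SortableRec.linearIndependent_coneRoot [Finite B] {δ : B → ℝ} (hpos : ∀ i, 0 < δ i)
    (hδ : ∀ i j, δ i * A i j = δ j * A j i) {l : List B} (hnd : l.Nodup) (hl : ∀ i, i ∈ l) {v : W}
    (hv : SortableRec cs l v) : LinearIndependent ℝ (coneRoot cs hA l v) := by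
  have := Fintype.ofFinite B
  refine linearIndependent_of_top_le_span_of_card_eq_finrank
    (hv.span_range_coneRoot cs hA hpos hδ hnd hl).ge ?_
  simp

end Fibres

end Cambrian

/-! ### The theorem. -/

theorem mainTheorem1 {B W : Type*} [Finite B] [Group W] {M : CoxeterMatrix B}
    (cs : CoxeterSystem M W) (c : W) (l : List B) (hl : Cambrian.IsCoxeterWord cs c l)
    (v : W) (hv : Cambrian.IsSortable cs c v) :
    (∀ w : W, Cambrian.piDown cs l w = v ↔
      Cambrian.cov cs v ⊆ Cambrian.inv cs w ∧
        Cambrian.ufs cs c v ∩ Cambrian.inv cs w = ∅) ∧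
    ∀ (A : Matrix B B ℝ) (hA : Cambrian.IsGeneralizedCartan M A),
      Cambrian.IsSymmetrizable cs A →
      LinearIndependent ℝ (Cambrian.coneRoot cs hA l v) ∧
      Submodule.span ℝ (Set.range (Cambrian.coneRoot cs hA l v)) = ⊤ ∧
      (∀ w : W, Cambrian.piDown cs l w = v ↔
        Cambrian.chamber cs hA w ⊆ Cambrian.cambrianCone cs hA l v) ∧
      (⋃ w ∈ {w : W | Cambrian.piDown cs l w = v}, Cambrian.chamber cs hA w) =
        Cambrian.cambrianCone cs hA l v ∩ Cambrian.titsCone cs hA := by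

  have hv' : Cambrian.SortableRec cs l v := by
    -- Sortability is witnessed by some reduced word of `c`, not necessarily `l`; commutation
    -- invariance transfers it.
    obtain ⟨l', hl', h⟩ := hv.exists_sortableRec
    exact (Cambrian.IsCoxeterWord.sortableRec_and_coneRoot cs
      (Cambrian.isGeneralizedCartan_standardCartan M) hl hl' v).1.mpr h
  refine ⟨fun w => ?_, ?_⟩
  -- Part 1 involves no matrix, so the standard symmetric one is used, with δ = 1.
  · have hpos : ∀ i : B, (0 : ℝ) < (fun _ => 1) i := fun _ => one_pos
    have hδ : ∀ i j : B, (fun _ => (1 : ℝ)) i * Cambrian.standardCartan M i j =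
        (fun _ => (1 : ℝ)) j * Cambrian.standardCartan M j i := fun i j => by
      rw [Cambrian.standardCartan_comm]
    have hA := Cambrian.isGeneralizedCartan_standardCartan M
    rw [hv'.piDown_eq_iff hA hpos hδ hl.1,
      Cambrian.forall_coneRoot_nonneg_iff cs hA hpos hδ hl hv']
  · rintro A hA ⟨δ, hpos, hδ, -⟩
    have hfib : ∀ w, Cambrian.piDown cs l w = v ↔
        ∀ r, 0 ≤ Cambrian.reflRep cs hA w⁻¹ (Cambrian.coneRoot cs hA l v r) := fun w => by
      rw [hv'.piDown_eq_iff hA hpos hδ hl.1]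
      exact forall_congr' fun r => forall_prop_of_true (hl.2.1 r)
    refine ⟨hv'.linearIndependent_coneRoot cs hA hpos hδ hl.1 hl.2.1,
      hv'.span_range_coneRoot cs hA hpos hδ hl.1 hl.2.1,
      fun w => by rw [hfib, Cambrian.chamber_subset_iff], ?_⟩
    ext x
    simp only [Set.mem_iUnion]
    constructor
    · rintro ⟨w, hw, hx⟩
      exact ⟨(Cambrian.chamber_subset_iff cs hA).mpr ((hfib w).mp hw) hx,
        Set.mem_iUnion.mpr ⟨w, hx⟩⟩
    · rintro ⟨hxC, hxT⟩
      obtain ⟨w, hw, hC⟩ := Cambrian.exists_chamber_subset cs hA hl.2.1 hv' hxT hxC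
      exact ⟨w, (hfib w).mpr hC, hw⟩
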